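/- Let $\Sigma_q=\{0,1,\dots,q-1\}$. For a word $x\in\Sigma_q^n$ let $\mathcal B^{\rm edit}_q(x)$ be the set of all words (of length $n-1$, $n$ or $n+1$ over $\Sigma_q$) obtained from $x$ by exactly one deletion, by at most one substitution, or by exactly one insertion. For a code $\mathcal C\subseteq\Sigma_q^n$ let $$\nu(\mathcal C;\mathcal B^{\rm edit}_q)=\max\{|\mathcal B^{\rm edit}_q(x)\cap \mathcal B^{\rm edit}_q(y)| : x,y\in\mathcal C,\ x\neq y\}$$ (the maximum of the empty set being $0$), and for $N\ge 1$ let $$\rho(n,N;\mathcal B^{\rm edit}_q)=\min\{\,n-\log_q|\mathcal C| : \emptyset\neq\mathcal C\subseteq\Sigma_q^n,\ \nu(\mathcal C;\mathcal B^{\rm edit}_q)<N\,\}.$$ Below, $q$ and $N$ are fixed and $n\to\infty$. An equation $\rho=f(n)+\Theta(1)$ means that $|\rho-f(n)|$ is bounded by a constant for all large $n$, $\rho=f(n)+O(g(n))$ means that $|\rho-f(n)|\le K\,|g(n)|$ for some constant $K$ and all large $n$ (the constants may depend on $q$ and $N$), and $o(1)$ denotes a function of $n$, possibly of either sign, that tends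 to $0$. Cases without a $\Theta$ or $O$ term hold for every $n\ge1$. 1. If $q=2$, then $$\rho(n,N;\mathcal B^{\rm edit}_2)=\begin{cases}\log_2 n+\Theta(1), & N\in\{1,2\},\\ \log_2\log_2 n+\Theta(1), & N\in\{3,4\},\\ 2-\epsilon(n), & N=5,\\ 1-\delta(n), & N=6,\\ 0, & N\ge 7,\end{cases}$$ where $0\le\epsilon(n)\le\log_2(4/3)-o(1)$, and $\delta(n)\ge 0$, $\delta(n)=o(1)$. 2. If $q\ge 3$, then $$\rho(n,N;\mathcal B^{\rm edit}_q)=\begin{cases}\log_q n+O(\log_q\log_q n), & N\in\{1,2\},\\ \log_q\log_q n+\Theta(1), & N\in\{3,4\},\\ 2-\epsilon(n), & N\in\{5,6\},\\ 1, & 7\le N\le q+3,\\ 0, & N\ge q+4,\end{cases}$$ where $0\le\epsilon(n)\le 1$ ($\epsilon$ may depend on $q$ and $N$). -/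

import Mathlib

open Filter Topology Asymptotics

/-- Words of length `n` over the alphabet `Σ_q = {0, …, q - 1}`. -/
abbrev Word (q n : ℕ) : Type := Fin n → Fin q

/-- All words obtained from `x` by at most one substitution. -/
def subBall {q n : ℕ} (x : Word q n) : Set (List (Fin q)) :=
  {z | z = List.ofFn x ∨
    ∃ (u v : List (Fin q)) (a b : Fin q), List.ofFn x = u ++ a :: v ∧ z = u ++ b :: v}

/-- All words obtained from `x` by exactly one insertion. -/
def insBall {q n : ℕ} (x : Word q n) : Set (List (Fin q)) :=
  {z | ∃ (u v : List (Fin q)) (a : Fin q), List.ofFn x = u ++ v ∧ z = u ++ a :: v}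

/-- All words obtained from `x` by exactly one deletion. -/
def delBall {q n : ℕ} (x : Word q n) : Set (List (Fin q)) :=
  {z | ∃ (u v : List (Fin q)) (a : Fin q), List.ofFn x = u ++ a :: v ∧ z = u ++ v}

/-- The single-edit error ball. -/
def editBall {q n : ℕ} (x : Word q n) : Set (List (Fin q)) :=
  subBall x ∪ insBall x ∪ delBall x

/-- The edit ball is finite, so that `Set.ncard` below is its true cardinality. -/
theorem editBall_finite {q n : ℕ} (x : Word q n) : (editBall x).Finite := by
  refine (List.finite_length_le (Fin q) (n + 1)).subset ?_
  rintro z ((h | ⟨u, v, a, h⟩) | ⟨u, v, a, h⟩)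
  · rcases h with rfl | ⟨u, v, a, b, hx, rfl⟩
    · simp
    · have := congrArg List.length hx
      simp at this ⊢
      omega
  · obtain ⟨hx, rfl⟩ := h
    have := congrArg List.length hx
    simp at this ⊢
    omega
  · obtain ⟨hx, rfl⟩ := h
    have := congrArg List.length hx
    simp at this ⊢
    omega

/-- The read coverage `ν(C; B)`: the largest size of `B x ∩ B y` over pairs of distinct
codewords `x`, `y` of `C` (and `0` if there is no such pair). -/
noncomputable def readCoverage {q n : ℕ} (B : Word q n → Set (List (Fin q)))
    (C : Finset (Word q n)) : ℕ :=
  C.offDiag.sup fun p => (B p.1 ∩ B p.2).ncard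

/-- `C` is an `(n, N; B)`-reconstruction code. -/
def IsReconstructionCode {q n : ℕ} (N : ℕ) (B : Word q n → Set (List (Fin q)))
    (C : Finset (Word q n)) : Prop :=
  readCoverage B C < N

/-- The redundancies `n - log_q |C|` of the (nonempty) `(n, N; B)`-reconstruction codes. -/
def redundancies {q n : ℕ} (N : ℕ) (B : Word q n → Set (List (Fin q))) : Set ℝ :=
  {r | ∃ C : Finset (Word q n), C.Nonempty ∧ IsReconstructionCode N B C ∧
    r = (n : ℝ) - Real.logb q C.card}

/-- The optimal redundancy `ρ(n, N; B)`. -/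
noncomputable def optRedundancy {q n : ℕ} (N : ℕ) (B : Word q n → Set (List (Fin q))) : ℝ :=
  sInf (redundancies N B)

/-- For `q, N ≥ 1` the infimum in `optRedundancy` is an attained minimum. -/
theorem optRedundancy_isLeast {q n : ℕ} (hq : 1 ≤ q) {N : ℕ} (hN : 1 ≤ N)
    (B : Word q n → Set (List (Fin q))) :
    IsLeast (redundancies N B) (optRedundancy N B) := by
  have hfin : (redundancies N B).Finite := by
    refine (Set.finite_range
      fun C : Finset (Word q n) => (n : ℝ) - Real.logb q C.card).subset ?_
    rintro r ⟨C, -, -, rfl⟩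
    exact ⟨C, rfl⟩
  have hne : (redundancies N B).Nonempty := by
    refine ⟨_, {fun _ => (⟨0, hq⟩ : Fin q)}, Finset.singleton_nonempty _, ?_, rfl⟩
    simp only [IsReconstructionCode, readCoverage, Finset.offDiag_singleton, Finset.sup_empty]
    exact hN
  exact ⟨hne.csInf_mem hfin, fun r hr => csInf_le hfin.bddBelow hr⟩

/-- `ρ(n, N; B^edit_q)`, the optimal redundancy for the single-edit error ball. -/
noncomputable def rhoEdit (q n N : ℕ) : ℝ :=
  optRedundancy N (editBall (q := q) (n := n))

/-! Length separates the three kinds of error, so the intersection of two balls splits into common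
substitutions, common insertions and common deletions. Let `i` and `j` be the first and last
positions where `x` and `y` differ (`DiffSpan`). A common insertion or deletion forces one word,
between `i` and `j`, to be the other shifted by one place (`Shift`). Each of the two directions
accounts for at most one common deletion and one common insertion. Common substitutions number at
most `q` at Hamming distance one, at most two at distance two, and none beyond. Hence the
intersection has at most `q + 3` words at distance one and at most 6 otherwise, and at distance two
or more it exceeds 4 only for transpositions of adjacent letters.

Upper bounds on the redundancy come from pigeonhole (`rhoEdit_le`): a large fibre of a suitable
invariant is a code. The invariants are residues of the letter sum `weightSum` and of the
position-weighted sum `moment`. The letter sum mod `q` excludes distance one, and the moment mod `q`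
excludes adjacent transpositions; this settles `N ≥ 5`. For `N = 3, 4`, half of all words have no
window of length `r = O(log n)` with period two, and among these the letter sum mod `q` with the
moment mod `q * r` leaves at most two common words (`ncard_editBall_inter_le_two`). For `N = 1, 2`
the moment is taken modulo a number linear in `n`. In the binary case this empties all
intersections, because the moment change of a shift is a sum of terms of one sign. For larger
alphabets such a sum may cancel. By an exponential moment bound half of all words have no long
cancelling window, and short ones are excluded by the moments of the letter indicators mod `k =
O(log n)`, at a cost of `O(log log n)`.

Lower bounds are packing arguments. Changing a fixed letter gives 1, and incrementing one arbitrary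
letter gives `log n`. The remaining ones use a set `A` of pairwise confusable blocks: replacing the
first block that lies in `A` by any member of `A` is injective on the code
(`card_mul_card_le_of_blocks`). Blocks of length two serve `N = 5, 6`, and the words `(ab)^i
(ba)^(m-i)` with `m` of order `log n` serve `N = 3, 4`. -/

/-! ### Shifts and the span of the differences -/

/-- The letter of `x` at position `p`, if there is one. -/
def letter {q n : ℕ} (x : Word q n) (p : ℕ) : Option (Fin q) := (List.ofFn x)[p]?

theorem letter_coe {q n : ℕ} (x : Word q n) (i : Fin n) : letter x i = some (x i) := by
  simp [letter]

theorem letter_of_lt {q n : ℕ} (x : Word q n) {p : ℕ} (h : p < n) :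
    letter x p = some (x ⟨p, h⟩) := by
  simp [letter, h]

theorem letter_of_le {q n : ℕ} (x : Word q n) {p : ℕ} (h : n ≤ p) : letter x p = none := by
  simp [letter, h]

/-- `x` and `y` have a common subword obtained by deleting position `s` of `x` and position
`t ≥ s` of `y`. -/
structure Shift {q n : ℕ} (x y : Word q n) (s t : ℕ) : Prop where
  le : s ≤ t
  lt : t < n
  left : ∀ p < s, letter x p = letter y p
  mid : ∀ p, s ≤ p → p < t → letter y p = letter x (p + 1)
  right : ∀ p, t < p → letter x p = letter y p

/-- The relation is directional: the position deleted from `x` is not to the right of the one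
deleted from `y`. A common deletion gives it in at least one direction. -/
def Shiftable {q n : ℕ} (x y : Word q n) : Prop := ∃ s t, Shift x y s t

/-- `i` is the first and `j` the last position where `x` and `y` differ. -/
structure DiffSpan {q n : ℕ} (x y : Word q n) (i j : Fin n) : Prop where
  le : i ≤ j
  left : x i ≠ y i
  right : x j ≠ y j
  before : ∀ p < i, x p = y p
  after : ∀ p, j < p → x p = y p

theorem DiffSpan.symm {q n : ℕ} {x y : Word q n} {i j : Fin n} (h : DiffSpan x y i j) :
    DiffSpan y x i j :=
  ⟨h.le, h.left.symm, h.right.symm, fun p hp => (h.before p hp).symm,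
    fun p hp => (h.after p hp).symm⟩

theorem exists_diffSpan {q n : ℕ} {x y : Word q n} (h : x ≠ y) : ∃ i j, DiffSpan x y i j := by
  classical
  let S : Finset (Fin n) := Finset.univ.filter fun p => x p ≠ y p
  have hS : S.Nonempty := by
    obtain ⟨p, hp⟩ := Function.ne_iff.1 h
    exact ⟨p, by simpa [S] using hp⟩
  have h1 := S.min'_mem hS
  have h2 := S.max'_mem hS
  refine ⟨S.min' hS, S.max' hS, S.min'_le _ h2, by simpa [S] using h1, by simpa [S] using h2, ?_, ?_⟩
  · intro p hp
    by_contra hne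
    exact absurd (S.min'_le p (by simpa [S] using hne)) (not_le.2 hp)
  · intro p hp
    by_contra hne
    exact absurd (S.le_max' p (by simpa [S] using hne)) (not_le.2 hp)

theorem DiffSpan.letter_before {q n : ℕ} {x y : Word q n} {i j : Fin n} (h : DiffSpan x y i j)
    {p : ℕ} (hp : p < i) : letter x p = letter y p := by
  have hn : p < n := hp.trans i.2
  rw [letter_of_lt x hn, letter_of_lt y hn, h.before ⟨p, hn⟩ hp]

theorem DiffSpan.letter_after {q n : ℕ} {x y : Word q n} {i j : Fin n} (h : DiffSpan x y i j)
    {p : ℕ} (hp : j < p) : letter x p = letter y p := by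
  by_cases hn : p < n
  · rw [letter_of_lt x hn, letter_of_lt y hn, h.after ⟨p, hn⟩ hp]
  · rw [letter_of_le x (not_lt.1 hn), letter_of_le y (not_lt.1 hn)]

/-- The words agree outside `[s, t]`, so that interval contains every difference. Every shift can
therefore be normalised to the one canonical interval `[i, j]`. -/
theorem Shift.restrict {q n : ℕ} {x y : Word q n} {i j : Fin n} {s t : ℕ} (h : Shift x y s t)
    (hd : DiffSpan x y i j) : s ≤ i ∧ j ≤ t ∧ Shift x y i j := by
  have hs : s ≤ i := by
    by_contra hlt
    have := h.left i (not_le.1 hlt)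
    rw [letter_coe, letter_coe] at this
    exact hd.left (Option.some.inj this)
  have ht : (j : ℕ) ≤ t := by
    by_contra hlt
    have := h.right j (not_le.1 hlt)
    rw [letter_coe, letter_coe] at this
    exact hd.right (Option.some.inj this)
  exact ⟨hs, ht, hd.le, j.2, fun p hp => hd.letter_before hp,
    fun p h1 h2 => h.mid p (hs.trans h1) (h2.trans_le ht), fun p hp => hd.letter_after hp⟩

/-! ### Upper bounds for the three kinds of common words -/

theorem mem_delBall_iff {q n : ℕ} {x : Word q n} {z : List (Fin q)} :
    z ∈ delBall x ↔ ∃ s < n, z = (List.ofFn x).eraseIdx s := by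
  constructor
  · rintro ⟨u, v, a, hx, rfl⟩
    refine ⟨u.length, ?_, ?_⟩
    · have := congrArg List.length hx
      simp at this
      omega
    · rw [hx, List.eraseIdx_append_of_length_le le_rfl]
      simp
  · rintro ⟨s, hs, rfl⟩
    have hs' : s < (List.ofFn x).length := by simpa using hs
    refine ⟨(List.ofFn x).take s, (List.ofFn x).drop (s + 1), (List.ofFn x)[s], ?_, ?_⟩
    · rw [List.cons_getElem_drop_succ, List.take_append_drop]
    · rw [List.eraseIdx_eq_take_drop_succ]

theorem mem_insBall_iff {q n : ℕ} {x : Word q n} {z : List (Fin q)} :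
    z ∈ insBall x ↔ z.length = n + 1 ∧ ∃ s ≤ n, z.eraseIdx s = List.ofFn x := by
  constructor
  · rintro ⟨u, v, a, hx, rfl⟩
    have := congrArg List.length hx
    simp at this
    refine ⟨by simp; omega, u.length, by omega, ?_⟩
    rw [hx, List.eraseIdx_append_of_length_le le_rfl]
    simp
  · rintro ⟨hl, s, hs, he⟩
    have hs' : s < z.length := by omega
    refine ⟨z.take s, z.drop (s + 1), z[s], ?_, ?_⟩
    · rw [← he, List.eraseIdx_eq_take_drop_succ]
    · rw [List.cons_getElem_drop_succ, List.take_append_drop]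

theorem ofFn_update {q n : ℕ} (x : Word q n) (k : Fin n) (c : Fin q) :
    List.ofFn (Function.update x k c) = (List.ofFn x).set k c := by
  apply List.ext_getElem
  · simp
  · intro p h1 h2
    simp [List.getElem_set, Function.update_apply, Fin.ext_iff, eq_comm]

theorem mem_subBall_iff {q n : ℕ} (hn : 0 < n) {x : Word q n} {z : List (Fin q)} :
    z ∈ subBall x ↔ ∃ k c, z = List.ofFn (Function.update x k c) := by
  constructor
  · rintro (rfl | ⟨u, v, a, b, hx, rfl⟩)
    · exact ⟨⟨0, hn⟩, x ⟨0, hn⟩, by simp⟩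
    · have hl := congrArg List.length hx
      simp at hl
      refine ⟨⟨u.length, by omega⟩, b, ?_⟩
      rw [ofFn_update, hx]
      simp
  · rintro ⟨k, c, rfl⟩
    have hk : (k : ℕ) < (List.ofFn x).length := by simp
    refine Or.inr ⟨(List.ofFn x).take k, (List.ofFn x).drop (k + 1), (List.ofFn x)[(k : ℕ)], c, ?_, ?_⟩
    · rw [List.cons_getElem_drop_succ, List.take_append_drop]
    · rw [ofFn_update, List.set_eq_take_append_cons_drop, if_pos hk]

theorem length_of_mem_subBall {q n : ℕ} {x : Word q n} {z : List (Fin q)} (h : z ∈ subBall x) :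
    z.length = n := by
  rcases h with rfl | ⟨u, v, a, b, hx, rfl⟩
  · simp
  · have hl := congrArg List.length hx
    simp at hl ⊢
    omega

theorem length_of_mem_delBall {q n : ℕ} {x : Word q n} {z : List (Fin q)} (h : z ∈ delBall x) :
    z.length + 1 = n := by
  obtain ⟨u, v, a, hx, rfl⟩ := h
  have hl := congrArg List.length hx
  simp at hl ⊢
  omega

theorem length_of_mem_insBall {q n : ℕ} {x : Word q n} {z : List (Fin q)} (h : z ∈ insBall x) :
    z.length = n + 1 := (mem_insBall_iff.1 h).1

theorem editBall_inter {q n : ℕ} (x y : Word q n) :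
    editBall x ∩ editBall y =
      (subBall x ∩ subBall y) ∪ (insBall x ∩ insBall y) ∪ (delBall x ∩ delBall y) := by
  ext z
  constructor
  · rintro ⟨(h1 | h1) | h1, (h2 | h2) | h2⟩
    · exact Or.inl (Or.inl ⟨h1, h2⟩)
    · have := length_of_mem_subBall h1
      have := length_of_mem_insBall h2
      omega
    · have := length_of_mem_subBall h1
      have := length_of_mem_delBall h2
      omega
    · have := length_of_mem_insBall h1
      have := length_of_mem_subBall h2
      omega
    · exact Or.inl (Or.inr ⟨h1, h2⟩)
    · have := length_of_mem_insBall h1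
      have := length_of_mem_delBall h2
      omega
    · have := length_of_mem_delBall h1
      have := length_of_mem_subBall h2
      omega
    · have := length_of_mem_delBall h1
      have := length_of_mem_insBall h2
      omega
    · exact Or.inr ⟨h1, h2⟩
  · rintro ((⟨h1, h2⟩ | ⟨h1, h2⟩) | ⟨h1, h2⟩)
    · exact ⟨Or.inl (Or.inl h1), Or.inl (Or.inl h2)⟩
    · exact ⟨Or.inl (Or.inr h1), Or.inl (Or.inr h2)⟩
    · exact ⟨Or.inr h1, Or.inr h2⟩

theorem ncard_editBall_inter_le {q n : ℕ} (x y : Word q n) :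
    (editBall x ∩ editBall y).ncard ≤ (subBall x ∩ subBall y).ncard +
      (insBall x ∩ insBall y).ncard + (delBall x ∩ delBall y).ncard := by
  rw [editBall_inter]
  exact (Set.ncard_union_le _ _).trans (Nat.add_le_add_right (Set.ncard_union_le _ _) _)

theorem shift_of_eraseIdx_eq {q n : ℕ} {x y : Word q n} {s t : ℕ} (hst : s ≤ t) (ht : t < n)
    (h : (List.ofFn x).eraseIdx s = (List.ofFn y).eraseIdx t) : Shift x y s t := by
  have key : ∀ p, (if p < s then letter x p else letter x (p + 1)) =
      if p < t then letter y p else letter y (p + 1) := by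
    intro p
    have := congrArg (fun l : List (Fin q) => l[p]?) h
    simpa only [List.getElem?_eraseIdx, letter] using this
  refine ⟨hst, ht, fun p hp => ?_, fun p h1 h2 => ?_, fun p hp => ?_⟩
  · simpa [hp, hp.trans_le hst] using key p
  · simpa [h2, not_lt.2 h1] using (key p).symm
  · obtain ⟨r, rfl⟩ : ∃ r, p = r + 1 := ⟨p - 1, by omega⟩
    have h1 : ¬ r < s := by omega
    have h2 : ¬ r < t := by omega
    simpa [h1, h2] using key r

/-- From `s` to `i` both `y p = x (p + 1)` and `y p = x p` hold, so `x` is constant there and it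
does not matter which letter of that run is deleted. Thus one direction yields only one common
subword. -/
theorem eraseIdx_eq_of_diffSpan {q n : ℕ} {x y : Word q n} {s t : ℕ} {i j : Fin n}
    (h : Shift x y s t) (hd : DiffSpan x y i j) :
    (List.ofFn x).eraseIdx s = (List.ofFn x).eraseIdx i := by
  obtain ⟨hs, ht, -⟩ := h.restrict hd
  apply List.ext_getElem?
  intro p
  rw [List.getElem?_eraseIdx, List.getElem?_eraseIdx]
  change (if p < s then letter x p else letter x (p + 1)) =
    if p < i then letter x p else letter x (p + 1)
  by_cases h1 : p < s
  · rw [if_pos h1, if_pos (h1.trans_le hs)]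
  · rw [if_neg h1]
    by_cases h2 : p < i
    · have hij : (i : ℕ) ≤ j := hd.le
      rw [if_pos h2, ← h.mid p (not_lt.1 h1) (by omega), hd.letter_before h2]
    · rw [if_neg h2]

theorem delBall_inter {q n : ℕ} {x y : Word q n} {i j : Fin n} (hd : DiffSpan x y i j)
    {z : List (Fin q)} (hz : z ∈ delBall x ∩ delBall y) :
    (Shiftable x y ∧ z = (List.ofFn x).eraseIdx i) ∨
      (Shiftable y x ∧ z = (List.ofFn y).eraseIdx i) := by
  obtain ⟨s, hs, h1⟩ := mem_delBall_iff.1 hz.1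
  obtain ⟨t, ht, h2⟩ := mem_delBall_iff.1 hz.2
  rcases le_total s t with hst | hst
  · have h := shift_of_eraseIdx_eq hst ht (h1.symm.trans h2)
    exact Or.inl ⟨⟨s, t, h⟩, h1.trans (eraseIdx_eq_of_diffSpan h hd)⟩
  · have h := shift_of_eraseIdx_eq hst hs (h2.symm.trans h1)
    exact Or.inr ⟨⟨t, s, h⟩, h2.trans (eraseIdx_eq_of_diffSpan h hd.symm)⟩

/-- The common superword `z` must read the common prefix, then `y i`, then the rest of `x` from `i`
on; so `z` is determined. Between the two insertion points `x` is the copy of `y` displaced by one,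
hence the shift from `y` to `x`. -/
theorem insBall_inter_aux {q n : ℕ} {x y : Word q n} {i j : Fin n} (hd : DiffSpan x y i j)
    {z : List (Fin q)} {s t : ℕ} (hst : s ≤ t) (ht : t ≤ n)
    (h1 : z.eraseIdx s = List.ofFn x) (h2 : z.eraseIdx t = List.ofFn y) :
    Shiftable y x ∧ ∀ p : ℕ, z[p]? =
      if p < i then letter x p else if p = i then letter y p else letter x (p - 1) := by
  have k1 : ∀ p, letter x p = if p < s then z[p]? else z[p + 1]? := by
    intro p
    rw [letter, ← h1, List.getElem?_eraseIdx]
  have k2 : ∀ p, letter y p = if p < t then z[p]? else z[p + 1]? := by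
    intro p
    rw [letter, ← h2, List.getElem?_eraseIdx]
  have hlt : s < t := by
    rcases hst.lt_or_eq with h | rfl
    · exact h
    · have := (k1 i).trans (k2 i).symm
      rw [letter_coe, letter_coe] at this
      exact absurd (Option.some.inj this) hd.left
  have hS : Shift y x s (t - 1) := by
    refine ⟨by omega, by omega, fun p hp => ?_, fun p hp hp' => ?_, fun p hp => ?_⟩
    · rw [k1, k2, if_pos hp, if_pos (by omega)]
    · rw [k1, k2, if_neg (by omega), if_pos (by omega)]
    · rw [k1, k2, if_neg (by omega), if_neg (by omega)]
  obtain ⟨hs, hj, -⟩ := hS.restrict hd.symm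
  have hij : (i : ℕ) ≤ j := hd.le
  refine ⟨⟨_, _, hS⟩, fun p => ?_⟩
  by_cases hp : p < i
  · rw [if_pos hp, hd.letter_before hp, k2, if_pos (by omega)]
  · rw [if_neg hp]
    by_cases hp' : p = i
    · rw [if_pos hp', k2, if_pos (by omega)]
    · rw [if_neg hp', k1, if_neg (by omega)]
      congr 1
      omega

theorem ncard_pair_le {α : Type*} (a b : α) : ({a, b} : Set α).ncard ≤ 2 :=
  (Set.ncard_insert_le a {b}).trans (by simp)

theorem ncard_le_of_two {α : Type*} (S : Set α) (P Q : Prop) [Decidable P] [Decidable Q]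
    (h1 : ∀ z ∈ S, P ∨ Q) (h2 : ∃ a b, ∀ z ∈ S, (P ∧ z = a) ∨ (Q ∧ z = b)) :
    S.ncard ≤ (if P then 1 else 0) + (if Q then 1 else 0) := by
  obtain ⟨a, b, h⟩ := h2
  by_cases hP : P <;> by_cases hQ : Q
  · have : S ⊆ {a, b} := fun z hz => by
      rcases h z hz with h | h
      · exact Or.inl h.2
      · exact Or.inr h.2
    simpa [hP, hQ] using (Set.ncard_le_ncard this (by simp)).trans (ncard_pair_le a b)
  · have : S ⊆ {a} := fun z hz => by
      rcases h z hz with h | h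
      · exact h.2
      · exact absurd h.1 hQ
    simpa [hP, hQ] using (Set.ncard_le_ncard this (by simp))
  · have : S ⊆ {b} := fun z hz => by
      rcases h z hz with h | h
      · exact absurd h.1 hP
      · exact h.2
    simpa [hP, hQ] using (Set.ncard_le_ncard this (by simp))
  · have : S = ∅ := Set.eq_empty_of_forall_notMem fun z hz => by
      rcases h1 z hz with h | h
      · exact hP h
      · exact hQ h
    simp [this]

open Classical in
theorem ncard_delBall_inter_le {q n : ℕ} {x y : Word q n} (hne : x ≠ y) :
    (delBall x ∩ delBall y).ncard ≤
      (if Shiftable x y then 1 else 0) + (if Shiftable y x then 1 else 0) := by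
  obtain ⟨i, j, hd⟩ := exists_diffSpan hne
  exact ncard_le_of_two _ _ _ (fun z hz => (delBall_inter hd hz).imp And.left And.left)
    ⟨_, _, fun z hz => delBall_inter hd hz⟩

/-- Nonemptiness only supplies a dummy witness when no member of `S` satisfies `P`. -/
theorem eq_of_unique {α : Type*} {S : Set α} {P : α → Prop}
    (h : ∀ z ∈ S, ∀ w ∈ S, P z → P w → z = w) (hne : S.Nonempty) :
    ∃ a, ∀ z ∈ S, P z → z = a := by
  by_cases hP : ∃ a ∈ S, P a
  · obtain ⟨a, ha, hPa⟩ := hP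
    exact ⟨a, fun z hz hPz => h z hz a ha hPz hPa⟩
  · obtain ⟨a, -⟩ := hne
    exact ⟨a, fun z hz hPz => absurd ⟨z, hz, hPz⟩ hP⟩

open Classical in
theorem ncard_insBall_inter_le {q n : ℕ} {x y : Word q n} (hne : x ≠ y) :
    (insBall x ∩ insBall y).ncard ≤
      (if Shiftable x y then 1 else 0) + (if Shiftable y x then 1 else 0) := by
  obtain ⟨i, j, hd⟩ := exists_diffSpan hne
  let P : List (Fin q) → Prop := fun z => ∀ p : ℕ, z[p]? =
      if p < i then letter y p else if p = i then letter x p else letter y (p - 1)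
  let Q : List (Fin q) → Prop := fun z => ∀ p : ℕ, z[p]? =
      if p < i then letter x p else if p = i then letter y p else letter x (p - 1)
  have key : ∀ z ∈ insBall x ∩ insBall y, (Shiftable x y ∧ P z) ∨ (Shiftable y x ∧ Q z) := by
    rintro z ⟨h1, h2⟩
    obtain ⟨-, s, hs, h1⟩ := mem_insBall_iff.1 h1
    obtain ⟨-, t, ht, h2⟩ := mem_insBall_iff.1 h2
    rcases le_total s t with hst | hst
    · exact Or.inr (insBall_inter_aux hd hst ht h1 h2)
    · exact Or.inl (insBall_inter_aux hd.symm hst hs h2 h1)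
  rcases (insBall x ∩ insBall y).eq_empty_or_nonempty with he | hn
  · simp [he]
  obtain ⟨a, ha⟩ := eq_of_unique (S := insBall x ∩ insBall y) (P := P)
    (fun z _ w _ h1 h2 => List.ext_getElem? fun p => (h1 p).trans (h2 p).symm) hn
  obtain ⟨b, hb⟩ := eq_of_unique (S := insBall x ∩ insBall y) (P := Q)
    (fun z _ w _ h1 h2 => List.ext_getElem? fun p => (h1 p).trans (h2 p).symm) hn
  exact ncard_le_of_two _ _ _ (fun z hz => (key z hz).imp And.left And.left)
    ⟨a, b, fun z hz => (key z hz).imp (fun h => ⟨h.1, ha z hz h.2⟩) fun h => ⟨h.1, hb z hz h.2⟩⟩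

/-- The two directions give the same word here, since deleting the single differing letter makes the
words equal. -/
theorem ncard_delBall_inter_le_one {q n : ℕ} {x y : Word q n} {i : Fin n}
    (hd : DiffSpan x y i i) : (delBall x ∩ delBall y).ncard ≤ 1 := by
  have he : (List.ofFn x).eraseIdx i = (List.ofFn y).eraseIdx i := by
    apply List.ext_getElem?
    intro p
    rw [List.getElem?_eraseIdx, List.getElem?_eraseIdx]
    split_ifs with h
    · exact hd.letter_before h
    · exact hd.letter_after (by omega)
  have : delBall x ∩ delBall y ⊆ {(List.ofFn x).eraseIdx i} := fun z hz => by
    rcases delBall_inter hd hz with h | h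
    · exact h.2
    · exact h.2.trans he.symm
  simpa using Set.ncard_le_ncard this (by simp)

theorem ncard_subBall_inter_one {q n : ℕ} {x y : Word q n} {i : Fin n}
    (hd : DiffSpan x y i i) : (subBall x ∩ subBall y).ncard ≤ q := by
  have hn : 0 < n := i.pos
  have : subBall x ∩ subBall y ⊆ Set.range fun c => List.ofFn (Function.update x i c) := by
    rintro z ⟨h1, h2⟩
    obtain ⟨k, c, rfl⟩ := (mem_subBall_iff hn).1 h1
    obtain ⟨l, d, h2⟩ := (mem_subBall_iff hn).1 h2
    have h2 := List.ofFn_injective h2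
    by_cases hk : k = i
    · exact ⟨c, by simp [hk]⟩
    · have hl : l = i := by
        by_contra hl
        have := congrFun h2 i
        rw [Function.update_of_ne (Ne.symm hk), Function.update_of_ne (Ne.symm hl)] at this
        exact hd.left this
      subst hl
      have hk' := congrFun h2 k
      rw [Function.update_self, Function.update_of_ne hk] at hk'
      have hxy : x k = y k := by
        rcases lt_or_gt_of_ne hk with h | h
        · exact hd.before k h
        · exact hd.after k h
      refine ⟨x l, ?_⟩
      simp [hk', ← hxy]
  refine (Set.ncard_le_ncard this (Set.finite_range _)).trans ?_
  rw [← Set.image_univ]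
  refine (Set.ncard_image_le (Set.finite_univ)).trans ?_
  simp [Set.ncard_univ]

theorem eq_of_update_eq_update {q n : ℕ} {x y : Word q n} {k l : Fin n} {c d : Fin q}
    (h : Function.update x k c = Function.update y l d) {p : Fin n} (hk : p ≠ k) (hl : p ≠ l) :
    x p = y p := by
  have := congrFun h p
  rwa [Function.update_of_ne hk, Function.update_of_ne hl] at this

theorem ncard_subBall_inter_two {q n : ℕ} {x y : Word q n} {i j : Fin n}
    (hd : DiffSpan x y i j) (hij : i ≠ j) : (subBall x ∩ subBall y).ncard ≤ 2 := by
  have hn : 0 < n := i.pos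
  have : subBall x ∩ subBall y ⊆ {List.ofFn (Function.update x i (y i)),
      List.ofFn (Function.update x j (y j))} := by
    rintro z ⟨h1, h2⟩
    obtain ⟨k, c, rfl⟩ := (mem_subBall_iff hn).1 h1
    obtain ⟨l, d, h2⟩ := (mem_subBall_iff hn).1 h2
    have h2 := List.ofFn_injective h2
    have hi : i = k ∨ i = l := by
      by_contra! h
      exact hd.left (eq_of_update_eq_update h2 h.1 h.2)
    have hj : j = k ∨ j = l := by
      by_contra! h
      exact hd.right (eq_of_update_eq_update h2 h.1 h.2)
    have hkl : k ≠ l := by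
      rintro rfl
      rcases hi with rfl | rfl <;> rcases hj with rfl | rfl <;> exact hij rfl
    have hk := congrFun h2 k
    rw [Function.update_self, Function.update_of_ne hkl] at hk
    subst hk
    rcases hi with rfl | rfl
    · exact Or.inl rfl
    · rcases hj with rfl | rfl
      · exact Or.inr rfl
      · exact absurd rfl hij
  exact (Set.ncard_le_ncard this (by simp)).trans (ncard_pair_le _ _)

theorem subBall_inter_eq_empty {q n : ℕ} {x y : Word q n} {i j k : Fin n}
    (hij : i < j) (hjk : j < k) (hi : x i ≠ y i) (hj : x j ≠ y j) (hk : x k ≠ y k) :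
    subBall x ∩ subBall y = ∅ := by
  have hn : 0 < n := i.pos
  refine Set.eq_empty_of_forall_notMem ?_
  rintro z ⟨h1, h2⟩
  obtain ⟨a, c, rfl⟩ := (mem_subBall_iff hn).1 h1
  obtain ⟨b, d, h2⟩ := (mem_subBall_iff hn).1 h2
  have h2 := List.ofFn_injective h2
  have key : ∀ p, x p ≠ y p → p = a ∨ p = b := by
    intro p hp
    by_contra! h
    exact hp (eq_of_update_eq_update h2 h.1 h.2)
  have := key i hi
  have := key j hj
  have := key k hk
  omega

/-! ### Weight sums and moments under shifts and substitutions -/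

/-- The sum of the weights of the letters of `x`. -/
def weightSum {q n : ℕ} (g : Fin q → ℤ) (x : Word q n) : ℤ := ∑ p, g (x p)

/-- The sum of the weights of the letters of `x`, each multiplied by its position. -/
def moment {q n : ℕ} (g : Fin q → ℤ) (x : Word q n) : ℤ := ∑ p : Fin n, (p : ℤ) * g (x p)

theorem sum_range_sub_of_shift (f h : ℕ → ℤ) {s t n : ℕ} (hst : s ≤ t) (ht : t < n)
    (hl : ∀ p < s, f p = h p) (hr : ∀ p, t < p → f p = h p) :
    ∑ p ∈ Finset.range n, f p - ∑ p ∈ Finset.range n, h p =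
      f s - h t + ∑ p ∈ Finset.Ico s t, (f (p + 1) - h p) := by
  have split : ∀ e : ℕ → ℤ, ∑ p ∈ Finset.range n, e p = ∑ p ∈ Finset.Ico 0 s, e p +
      ∑ p ∈ Finset.Ico s (t + 1), e p + ∑ p ∈ Finset.Ico (t + 1) n, e p := by
    intro e
    rw [Finset.sum_Ico_consecutive _ (Nat.zero_le s) (by omega),
      Finset.sum_Ico_consecutive _ (Nat.zero_le _) (by omega), Finset.range_eq_Ico]
  have e1 : ∑ p ∈ Finset.Ico 0 s, f p = ∑ p ∈ Finset.Ico 0 s, h p :=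
    Finset.sum_congr rfl fun p hp => hl p (Finset.mem_Ico.1 hp).2
  have e2 : ∑ p ∈ Finset.Ico (t + 1) n, f p = ∑ p ∈ Finset.Ico (t + 1) n, h p :=
    Finset.sum_congr rfl fun p hp => hr p (Finset.mem_Ico.1 hp).1
  have e3 : ∑ p ∈ Finset.Ico s (t + 1), f p = f s + ∑ p ∈ Finset.Ico s t, f (p + 1) := by
    rw [Finset.sum_eq_sum_Ico_succ_bot (by omega), Finset.sum_Ico_add' f s t 1]
  have e4 : ∑ p ∈ Finset.Ico s (t + 1), h p = ∑ p ∈ Finset.Ico s t, h p + h t :=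
    Finset.sum_Ico_succ_top hst h
  rw [split f, split h, e1, e2, e3, e4, Finset.sum_sub_distrib]
  ring

theorem weightSum_eq_range {q n : ℕ} (g : Fin q → ℤ) (x : Word q n) :
    weightSum g x = ∑ p ∈ Finset.range n, (letter x p).elim 0 g := by
  rw [Finset.sum_range]
  exact Finset.sum_congr rfl fun p _ => by rw [letter_coe]; rfl

theorem moment_eq_range {q n : ℕ} (g : Fin q → ℤ) (x : Word q n) :
    moment g x = ∑ p ∈ Finset.range n, (p : ℤ) * (letter x p).elim 0 g := by
  rw [Finset.sum_range]
  exact Finset.sum_congr rfl fun p _ => by rw [letter_coe]; rfl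

theorem Shift.weightSum_sub {q n : ℕ} {x y : Word q n} {i j : Fin n} (h : Shift x y i j)
    (g : Fin q → ℤ) : weightSum g x - weightSum g y = g (x i) - g (y j) := by
  rw [weightSum_eq_range, weightSum_eq_range, sum_range_sub_of_shift _ _ h.le h.lt
    (fun p hp => by rw [h.left p hp]) (fun p hp => by rw [h.right p hp])]
  rw [Finset.sum_eq_zero, letter_coe, letter_coe]
  · simp
  · intro p hp
    rw [h.mid p (Finset.mem_Ico.1 hp).1 (Finset.mem_Ico.1 hp).2, sub_self]

theorem sum_Ico_coe {n : ℕ} (f : ℕ → ℤ) (i j : Fin n) :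
    ∑ p ∈ Finset.Ico (i : ℕ) j, f p = ∑ p ∈ Finset.Ico i j, f p := by
  rw [← Fin.map_valEmbedding_Ico, Finset.sum_map]
  rfl

/-- Every letter `y p` with `i ≤ p < j` sits one place further right in `x` and contributes its
weight once. The letter at the end of the stretch moves back from `j` to `i`, which costs its weight
`j - i` times. -/
theorem Shift.moment_sub {q n : ℕ} {x y : Word q n} {i j : Fin n} (h : Shift x y i j)
    (g : Fin q → ℤ) (hg : g (x i) = g (y j)) :
    moment g x - moment g y = ∑ p ∈ Finset.Ico i j, (g (y p) - g (x i)) := by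
  rw [moment_eq_range, moment_eq_range, sum_range_sub_of_shift _ _ h.le h.lt
    (fun p hp => by rw [h.left p hp]) (fun p hp => by rw [h.right p hp])]
  have hij : (i : ℕ) ≤ j := h.le
  have : ∑ p ∈ Finset.Ico (i : ℕ) j, (((p + 1 : ℕ) : ℤ) * (letter x (p + 1)).elim 0 g -
      (p : ℤ) * (letter y p).elim 0 g) = ∑ p ∈ Finset.Ico i j, g (y p) := by
    rw [sum_Ico_coe]
    refine Finset.sum_congr rfl fun p hp => ?_
    rw [← h.mid p (Finset.mem_Ico.1 hp).1 (Finset.mem_Ico.1 hp).2, letter_coe]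
    simp only [Option.elim_some]
    push_cast
    ring
  rw [this, letter_coe, letter_coe, Finset.sum_sub_distrib, Finset.sum_const, Fin.card_Ico]
  simp only [Option.elim_some, ← hg, nsmul_eq_mul, Nat.cast_sub hij]
  ring

theorem weightSum_sub {q n : ℕ} (g : Fin q → ℤ) (x y : Word q n) :
    weightSum g x - weightSum g y = ∑ p, (g (x p) - g (y p)) := by
  simp [weightSum]

theorem moment_sub {q n : ℕ} (g : Fin q → ℤ) (x y : Word q n) :
    moment g x - moment g y = ∑ p : Fin n, (p : ℤ) * (g (x p) - g (y p)) := by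
  simp [moment, mul_sub]

theorem DiffSpan.weightSum_sub_of_eq {q n : ℕ} {x y : Word q n} {i : Fin n}
    (h : DiffSpan x y i i) (g : Fin q → ℤ) :
    weightSum g x - weightSum g y = g (x i) - g (y i) := by
  rw [weightSum_sub]
  refine Finset.sum_eq_single i (fun p _ hp => ?_) (by simp)
  rcases lt_or_gt_of_ne hp with hp | hp
  · rw [h.before p hp, sub_self]
  · rw [h.after p hp, sub_self]

theorem DiffSpan.eq_of_ne {q n : ℕ} {x y : Word q n} {i j : Fin n} (h : DiffSpan x y i j)
    (hm : ∀ p, i < p → p < j → x p = y p) {p : Fin n} (hi : p ≠ i) (hj : p ≠ j) : x p = y p := by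
  rcases lt_or_gt_of_ne hi with h1 | h1
  · exact h.before p h1
  rcases lt_or_gt_of_ne hj with h2 | h2
  · exact hm p h1 h2
  · exact h.after p h2

theorem DiffSpan.weightSum_sub_of_two {q n : ℕ} {x y : Word q n} {i j : Fin n}
    (h : DiffSpan x y i j) (hij : i ≠ j) (hm : ∀ p, i < p → p < j → x p = y p) (g : Fin q → ℤ) :
    weightSum g x - weightSum g y = (g (x i) - g (y i)) + (g (x j) - g (y j)) := by
  rw [weightSum_sub]
  refine Finset.sum_eq_add i j hij (fun p _ hp => ?_) (by simp) (by simp)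
  rw [h.eq_of_ne hm hp.1 hp.2, sub_self]

theorem DiffSpan.moment_sub_of_two {q n : ℕ} {x y : Word q n} {i j : Fin n}
    (h : DiffSpan x y i j) (hij : i ≠ j) (hm : ∀ p, i < p → p < j → x p = y p) (g : Fin q → ℤ) :
    moment g x - moment g y = i * (g (x i) - g (y i)) + j * (g (x j) - g (y j)) := by
  rw [moment_sub]
  refine Finset.sum_eq_add i j hij (fun p _ hp => ?_) (by simp) (by simp)
  rw [h.eq_of_ne hm hp.1 hp.2, sub_self, mul_zero]

/-! ### From code sizes to redundancy -/

theorem isReconstructionCode_iff {q n N : ℕ} (hN : 1 ≤ N) {B : Word q n → Set (List (Fin q))}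
    {C : Finset (Word q n)} :
    IsReconstructionCode N B C ↔ ∀ x ∈ C, ∀ y ∈ C, x ≠ y → (B x ∩ B y).ncard < N := by
  rw [IsReconstructionCode, readCoverage, Finset.sup_lt_iff (by exact hN)]
  constructor
  · intro h x hx y hy hxy
    exact h (x, y) (Finset.mem_offDiag.2 ⟨hx, hy, hxy⟩)
  · rintro h ⟨x, y⟩ hp
    obtain ⟨hx, hy, hxy⟩ := Finset.mem_offDiag.1 hp
    exact h x hx y hy hxy

/-- Some fibre of `Φ` on `G` has at least `|G| / |K|` elements, and it is a code. The factor `c`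
pays for restricting to a set `G` of well-behaved words. -/
theorem rhoEdit_le {q n N : ℕ} (hq : 2 ≤ q) (hN : 1 ≤ N) {K : Type*} [Fintype K] [DecidableEq K]
    (Φ : Word q n → K) (G : Finset (Word q n)) {c : ℝ} (hc : (q : ℝ) ^ n ≤ c * G.card)
    (h : ∀ x ∈ G, ∀ y ∈ G, x ≠ y → Φ x = Φ y → (editBall x ∩ editBall y).ncard < N) :
    rhoEdit q n N ≤ Real.logb q (c * Fintype.card K) := by
  have hq0 : (0 : ℝ) < q := by positivity
  have hq1 : (1 : ℝ) < q := by exact_mod_cast hq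
  have hpow : (0 : ℝ) < (q : ℝ) ^ n := by positivity
  have hG : 0 < (G.card : ℝ) := by
    rcases (Nat.cast_nonneg G.card : (0 : ℝ) ≤ G.card).lt_or_eq with h | h
    · exact h
    · rw [← h] at hc
      linarith
  have hGne : G.Nonempty := Finset.card_pos.1 (by exact_mod_cast hG)
  have hc0 : 0 < c := pos_of_mul_pos_left (hpow.trans_le hc) hG.le
  obtain ⟨x0, hx0⟩ := hGne
  have : Nonempty K := ⟨Φ x0⟩
  have hK : (0 : ℝ) < Fintype.card K := by exact_mod_cast Fintype.card_pos
  obtain ⟨k, -, hk⟩ := Finset.exists_le_card_fiber_of_nsmul_le_card_of_maps_to (s := G)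
    (t := (Finset.univ : Finset K)) (f := Φ) (b := (G.card : ℝ) / Fintype.card K)
    (fun _ _ => Finset.mem_univ _) Finset.univ_nonempty
    (by rw [nsmul_eq_mul, Finset.card_univ, mul_div_cancel₀ _ hK.ne'])
  set C := G.filter fun x => Φ x = k with hC
  have hCpos : 0 < (C.card : ℝ) := (div_pos hG hK).trans_le hk
  have hmem : (n : ℝ) - Real.logb q C.card ∈ redundancies N (editBall (q := q) (n := n)) := by
    refine ⟨C, Finset.card_pos.1 (by exact_mod_cast hCpos), ?_, rfl⟩
    rw [isReconstructionCode_iff hN]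
    intro x hx y hy hxy
    rw [hC, Finset.mem_filter] at hx hy
    exact h x hx.1 y hy.1 hxy (hx.2.trans hy.2.symm)
  refine ((optRedundancy_isLeast (by omega) hN _).2 hmem).trans ?_
  rw [sub_le_iff_le_add, ← Real.logb_mul (by positivity) hCpos.ne', Real.le_logb_iff_rpow_le hq1
    (by positivity), Real.rpow_natCast]
  rw [div_le_iff₀ hK] at hk
  calc (q : ℝ) ^ n ≤ c * G.card := hc
    _ ≤ c * (C.card * Fintype.card K) := by gcongr
    _ = c * Fintype.card K * C.card := by ring

theorem le_rhoEdit {q n N : ℕ} (hq : 2 ≤ q) (hN : 1 ≤ N) {B : ℝ}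
    (h : ∀ C : Finset (Word q n), C.Nonempty →
      (∀ x ∈ C, ∀ y ∈ C, x ≠ y → (editBall x ∩ editBall y).ncard < N) → (C.card : ℝ) ≤ B) :
    (n : ℝ) - Real.logb q B ≤ rhoEdit q n N := by
  obtain ⟨C, hne, hrec, he⟩ :=
    (optRedundancy_isLeast (by omega) hN (editBall (q := q) (n := n))).1
  rw [rhoEdit, he]
  have hq1 : (1 : ℝ) < q := by exact_mod_cast hq
  have hpos : 0 < (C.card : ℝ) := by exact_mod_cast hne.card_pos
  have := h C hne ((isReconstructionCode_iff hN).1 hrec)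
  gcongr

theorem rhoEdit_nonneg {q n N : ℕ} (hq : 2 ≤ q) (hN : 1 ≤ N) : 0 ≤ rhoEdit q n N := by
  have := le_rhoEdit (n := n) hq hN (B := (q : ℝ) ^ n) fun C _ _ => by
    have := Finset.card_le_univ C
    simp at this
    exact_mod_cast this
  have hq1 : (1 : ℝ) < q := by exact_mod_cast hq
  rwa [Real.logb_pow, Real.logb_self_eq_one hq1, mul_one, sub_self] at this

/-! ### Ball intersections by Hamming distance, and codes of constant redundancy -/

theorem ncard_editBall_inter_le_of_one {q n : ℕ} {x y : Word q n} {i : Fin n}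
    (hd : DiffSpan x y i i) : (editBall x ∩ editBall y).ncard ≤ q + 3 := by
  classical
  have hne : x ≠ y := fun h => hd.left (by rw [h])
  have h1 := ncard_editBall_inter_le x y
  have h2 := ncard_subBall_inter_one hd
  have h3 := ncard_delBall_inter_le_one hd
  have h4 := ncard_insBall_inter_le hne
  split_ifs at h4 <;> omega

open Classical in
theorem ncard_editBall_inter_le_of_two {q n : ℕ} {x y : Word q n} {i j : Fin n}
    (hd : DiffSpan x y i j) (hij : i ≠ j) : (editBall x ∩ editBall y).ncard ≤
      2 + 2 * ((if Shiftable x y then 1 else 0) + (if Shiftable y x then 1 else 0)) := by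
  have hne : x ≠ y := fun h => hd.left (by rw [h])
  have h1 := ncard_editBall_inter_le x y
  have h2 := ncard_subBall_inter_two hd hij
  have h3 := ncard_delBall_inter_le hne
  have h4 := ncard_insBall_inter_le hne
  omega

open Classical in
theorem ncard_editBall_inter_le_of_three {q n : ℕ} {x y : Word q n} {i j : Fin n}
    (hd : DiffSpan x y i j) (hm : ¬ ∀ p, i < p → p < j → x p = y p) :
    (editBall x ∩ editBall y).ncard ≤
      2 * ((if Shiftable x y then 1 else 0) + (if Shiftable y x then 1 else 0)) := by
  have hne : x ≠ y := fun h => hd.left (by rw [h])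
  push Not at hm
  obtain ⟨p, hip, hpj, hp⟩ := hm
  have h1 := ncard_editBall_inter_le x y
  have h2 := subBall_inter_eq_empty hip hpj hd.left hp hd.right
  have h3 := ncard_delBall_inter_le hne
  have h4 := ncard_insBall_inter_le hne
  rw [h2, Set.ncard_empty] at h1
  omega

theorem ncard_editBall_inter_le_six {q n : ℕ} {x y : Word q n} {i j : Fin n}
    (hd : DiffSpan x y i j) (hij : i ≠ j) : (editBall x ∩ editBall y).ncard ≤ 6 := by
  classical
  have := ncard_editBall_inter_le_of_two hd hij
  split_ifs at this <;> omega

/-- If `x` and `y` differ in at least two positions, but not by a transposition of adjacent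
letters, then the intersection of their balls is small. -/
theorem ncard_editBall_inter_le_four {q n : ℕ} {x y : Word q n} {i j : Fin n}
    (hd : DiffSpan x y i j) (hij : i ≠ j)
    (h : (j : ℕ) = i + 1 → x i = y j → x j = y i → False) :
    (editBall x ∩ editBall y).ncard ≤ 4 := by
  classical
  by_cases hm : ∀ p, i < p → p < j → x p = y p
  · have h2 := ncard_editBall_inter_le_of_two hd hij
    -- Shifts both ways give `y i = x (i + 1)` and `x i = y (i + 1)`. If `j = i + 1` this is a
    -- transposition; otherwise `x` and `y` agree at `i + 1`, forcing `x i = y i`.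
    have : ¬ (Shiftable x y ∧ Shiftable y x) := by
      rintro ⟨⟨s, t, h1⟩, ⟨s', t', h2⟩⟩
      obtain ⟨-, -, h1⟩ := h1.restrict hd
      obtain ⟨-, -, h2⟩ := h2.restrict hd.symm
      have hlt : (i : ℕ) < j := lt_of_le_of_ne hd.le fun h => hij (Fin.ext h)
      have hn : (i : ℕ) + 1 < n := by omega
      have e1 := h1.mid i le_rfl hlt
      have e2 := h2.mid i le_rfl hlt
      rw [letter_coe, letter_of_lt _ hn] at e1 e2
      have e1 := Option.some.inj e1
      have e2 := Option.some.inj e2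
      by_cases hj : (j : ℕ) = i + 1
      · have : (⟨i + 1, hn⟩ : Fin n) = j := Fin.ext hj.symm
        rw [this] at e1 e2
        exact h hj e2 e1.symm
      · have := hm ⟨i + 1, hn⟩ (Nat.lt_succ_self i)
          (show (i : ℕ) + 1 < j by omega)
        exact hd.left (e2.trans (this.symm.trans e1.symm))
    rcases not_and_or.1 this with h | h <;> rw [if_neg h] at h2 <;> split_ifs at h2 <;> omega
  · have h2 := ncard_editBall_inter_le_of_three hd hm
    split_ifs at h2 <;> omega

/-- The weight of a letter given by its value. -/
def letterValue {q : ℕ} (c : Fin q) : ℤ := (c : ℕ)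

theorem letterValue_injective {q : ℕ} : Function.Injective (letterValue (q := q)) := by
  intro a b h
  exact Fin.ext (by simpa [letterValue] using h)

theorem letterValue_sub_lt {q : ℕ} (a b : Fin q) : |letterValue a - letterValue b| < q := by
  have := a.2
  have := b.2
  simp only [letterValue, abs_lt]
  omega

theorem letterValue_eq_of_dvd {q : ℕ} {a b : Fin q} (h : (q : ℤ) ∣ letterValue a - letterValue b) :
    a = b :=
  letterValue_injective (sub_eq_zero.1 (Int.eq_zero_of_abs_lt_dvd h (letterValue_sub_lt a b)))

theorem dvd_sub_of_cast_eq {m : ℕ} {a b : ℤ} (h : (a : ZMod m) = b) : (m : ℤ) ∣ a - b := by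
  rw [← ZMod.intCast_zmod_eq_zero_iff_dvd, Int.cast_sub, h, sub_self]

theorem DiffSpan.ne_of_weightSum {q n m : ℕ} {x y : Word q n} {i j : Fin n} {g : Fin q → ℤ}
    (hd : DiffSpan x y i j) (h : (weightSum g x : ZMod m) = weightSum g y)
    (hg : ∀ a b, (m : ℤ) ∣ g a - g b → a = b) : i ≠ j := by
  rintro rfl
  have := dvd_sub_of_cast_eq h
  rw [hd.weightSum_sub_of_eq] at this
  exact hd.left (hg _ _ this)

/-- An adjacent transposition changes the moment by the difference of the two letter values, which
is nonzero and smaller than `q` in absolute value. -/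
theorem DiffSpan.not_transposition {q n : ℕ} {x y : Word q n} {i j : Fin n}
    (hd : DiffSpan x y i j) (h : (moment letterValue x : ZMod q) = moment letterValue y)
    (hj : (j : ℕ) = i + 1) (h1 : x i = y j) (h2 : x j = y i) : False := by
  have := dvd_sub_of_cast_eq h
  have hij : i ≠ j := fun h => by rw [h] at hj; omega
  rw [hd.moment_sub_of_two hij (fun p hip hpj => ?_), ← h1, h2, hj] at this
  · have e : (i : ℤ) * (letterValue (x i) - letterValue (y i)) + (i + 1 : ℕ) *
        (letterValue (y i) - letterValue (x i)) = letterValue (y i) - letterValue (x i) := by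
      push_cast
      ring
    rw [e] at this
    exact hd.left (letterValue_eq_of_dvd this).symm
  · have h3 : (i : ℕ) < p := hip
    have h4 : (p : ℕ) < j := hpj
    omega

theorem rhoEdit_eq_zero {q n N : ℕ} (hq : 2 ≤ q) (h1 : 7 ≤ N) (h2 : q + 4 ≤ N ) :
    rhoEdit q n N = 0 := by
  refine le_antisymm ?_ (rhoEdit_nonneg hq (by omega))
  have := rhoEdit_le hq (show 1 ≤ N by omega) (fun _ : Word q n => ()) Finset.univ (c := 1)
    (by simp) fun x _ y _ hxy _ => by
      obtain ⟨i, j, hd⟩ := exists_diffSpan hxy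
      by_cases hij : i = j
      · subst hij
        have := ncard_editBall_inter_le_of_one hd
        omega
      · have := ncard_editBall_inter_le_six hd hij
        omega
  simpa using this

theorem rhoEdit_le_one {q n N : ℕ} (hq : 2 ≤ q) (h1 : 7 ≤ N) : rhoEdit q n N ≤ 1 := by
  have : NeZero q := ⟨by omega⟩
  have := rhoEdit_le hq (show 1 ≤ N by omega)
    (fun x : Word q n => (weightSum letterValue x : ZMod q)) Finset.univ (c := 1)
    (by simp) fun x _ y _ hxy h => by
      obtain ⟨i, j, hd⟩ := exists_diffSpan hxy
      have hij := hd.ne_of_weightSum h fun _ _ => letterValue_eq_of_dvd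
      have := ncard_editBall_inter_le_six hd hij
      omega
  have hq1 : (1 : ℝ) < q := by exact_mod_cast hq
  simpa [ZMod.card, Real.logb_self_eq_one hq1] using this

theorem rhoEdit_le_two {q n N : ℕ} (hq : 2 ≤ q) (h1 : 5 ≤ N) : rhoEdit q n N ≤ 2 := by
  have : NeZero q := ⟨by omega⟩
  have := rhoEdit_le hq (show 1 ≤ N by omega) (fun x : Word q n =>
      ((weightSum letterValue x : ZMod q), (moment letterValue x : ZMod q))) Finset.univ (c := 1)
    (by simp) fun x _ y _ hxy h => by
      obtain ⟨i, j, hd⟩ := exists_diffSpan hxy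
      have hij := hd.ne_of_weightSum (congrArg Prod.fst h) fun _ _ => letterValue_eq_of_dvd
      have := ncard_editBall_inter_le_four hd hij (hd.not_transposition (congrArg Prod.snd h))
      omega
  have hq1 : (1 : ℝ) < q := by exact_mod_cast hq
  have h2 : Real.logb q ((q : ℝ) * q) = 2 := by
    rw [Real.logb_mul (by positivity) (by positivity), Real.logb_self_eq_one hq1]
    norm_num
  simpa [ZMod.card, h2] using this

/-- Binary words at distance one share at most 5 words, so only adjacent transpositions need
excluding, and the parity of the moment does that. -/
theorem rhoEdit_two_six_le {n : ℕ} : rhoEdit 2 n 6 ≤ 1 := by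
  have := rhoEdit_le le_rfl (show 1 ≤ 6 by omega) (fun x : Word 2 n =>
      (moment letterValue x : ZMod 2)) Finset.univ (c := 1)
    (by simp) fun x _ y _ hxy h => by
      obtain ⟨i, j, hd⟩ := exists_diffSpan hxy
      by_cases hij : i = j
      · subst hij
        have := ncard_editBall_inter_le_of_one hd
        omega
      · have := ncard_editBall_inter_le_four hd hij (hd.not_transposition h)
        omega
  simpa [ZMod.card] using this

/-! ### Lower bounds for ball intersections -/

theorem le_ncard_editBall_inter {q n : ℕ} {x y : Word q n} {a b c : ℕ}
    (ha : a ≤ (subBall x ∩ subBall y).ncard) (hb : b ≤ (insBall x ∩ insBall y).ncard)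
    (hc : c ≤ (delBall x ∩ delBall y).ncard) : a + b + c ≤ (editBall x ∩ editBall y).ncard := by
  have hfin := (editBall_finite x).inter_of_left (editBall y)
  rw [editBall_inter] at hfin ⊢
  have hf := Set.finite_union.1 hfin
  have hf' := Set.finite_union.1 hf.1
  rw [Set.ncard_union_eq _ hf.1 hf.2, Set.ncard_union_eq _ hf'.1 hf'.2]
  · omega
  · rw [Set.disjoint_left]
    intro z h1 h2
    have := length_of_mem_subBall h1.1
    have := length_of_mem_insBall h2.1
    omega
  · rw [Set.disjoint_left]
    rintro z (h1 | h1) h2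
    · have := length_of_mem_subBall h1.1
      have := length_of_mem_delBall h2.1
      omega
    · have := length_of_mem_insBall h1.1
      have := length_of_mem_delBall h2.1
      omega

theorem subBall_finite {q n : ℕ} (x : Word q n) : (subBall x).Finite :=
  (editBall_finite x).subset fun _ h => Or.inl (Or.inl h)

theorem insBall_finite {q n : ℕ} (x : Word q n) : (insBall x).Finite :=
  (editBall_finite x).subset fun _ h => Or.inl (Or.inr h)

theorem delBall_finite {q n : ℕ} (x : Word q n) : (delBall x).Finite :=
  (editBall_finite x).subset fun _ h => Or.inr h

theorem two_le_ncard {α : Type*} {S : Set α} (hS : S.Finite) {a b : α} (ha : a ∈ S) (hb : b ∈ S)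
    (hab : a ≠ b) : 2 ≤ S.ncard := by
  rw [← Set.ncard_pair hab]
  refine Set.ncard_le_ncard ?_ hS
  rintro z (rfl | rfl)
  · exact ha
  · exact hb

theorem update_mem_subBall {q n : ℕ} (x : Word q n) (k : Fin n) (c : Fin q) :
    List.ofFn (Function.update x k c) ∈ subBall x :=
  (mem_subBall_iff k.pos).2 ⟨k, c, rfl⟩

theorem two_le_ncard_subBall_inter {q n : ℕ} {x y : Word q n} (hne : x ≠ y) {i j : Fin n}
    (hij : i ≠ j) (h : ∀ p, p ≠ i → p ≠ j → x p = y p) :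
    2 ≤ (subBall x ∩ subBall y).ncard := by
  have e1 : Function.update x j (y j) = Function.update y i (x i) := by
    funext p
    by_cases hi : p = i
    · subst hi
      simp [hij]
    · by_cases hj : p = j
      · subst hj
        simp [hi]
      · simp [hi, hj, h p hi hj]
  have e2 : Function.update x i (y i) = Function.update y j (x j) := by
    funext p
    by_cases hi : p = i
    · subst hi
      simp [hij]
    · by_cases hj : p = j
      · subst hj
        simp [hi]
      · simp [hi, hj, h p hi hj]
  refine two_le_ncard ((subBall_finite x).inter_of_left _) (a := List.ofFn (Function.update x j (y j)))
    (b := List.ofFn (Function.update x i (y i)))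
    ⟨update_mem_subBall _ _ _, e1 ▸ update_mem_subBall _ _ _⟩
    ⟨update_mem_subBall _ _ _, e2 ▸ update_mem_subBall _ _ _⟩ ?_
  intro he
  have he := List.ofFn_injective he
  refine hne (funext fun p => ?_)
  by_cases hi : p = i
  · subst hi
    have := congrFun he p
    rwa [Function.update_self, Function.update_of_ne hij] at this
  · by_cases hj : p = j
    · subst hj
      have := congrFun he p
      rw [Function.update_self, Function.update_of_ne hi] at this
      exact this.symm
    · exact h p hi hj

theorem le_ncard_subBall_inter {q n : ℕ} {x y : Word q n} {i : Fin n}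
    (h : ∀ p, p ≠ i → x p = y p) : q ≤ (subBall x ∩ subBall y).ncard := by
  have hinj : Function.Injective fun c => List.ofFn (Function.update x i c) :=
    List.ofFn_injective.comp (Function.update_injective x i)
  calc q = (Set.range fun c => List.ofFn (Function.update x i c)).ncard := by
        rw [← Set.image_univ, Set.ncard_image_of_injective _ hinj, Set.ncard_univ, Nat.card_fin]
    _ ≤ _ := by
        refine Set.ncard_le_ncard ?_ ((subBall_finite x).inter_of_left _)
        rintro z ⟨c, rfl⟩
        refine ⟨update_mem_subBall _ _ _, ?_⟩
        have : Function.update x i c = Function.update y i c := by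
          funext p
          by_cases hp : p = i
          · subst hp
            simp
          · simp [hp, h p hp]
        dsimp only
        rw [this]
        exact update_mem_subBall _ _ _

/-- The hypotheses say that extending `v'` on the left equals extending `v` on the right, and
conversely. So the two extensions are superwords of both `x` and `y`; they differ in the letter
after `u`. -/
theorem two_le_ncard_insBall_inter {q n : ℕ} {x y : Word q n} {u v w : List (Fin q)} {a b c d : Fin q}
    {v' : List (Fin q)} (hx : List.ofFn x = u ++ v ++ w) (hy : List.ofFn y = u ++ v' ++ w)
    (h1 : a :: v' = v ++ [c]) (h2 : b :: v = v' ++ [d]) (hab : a ≠ b) :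
    2 ≤ (insBall x ∩ insBall y).ncard := by
  refine two_le_ncard ((insBall_finite x).inter_of_left _) (a := u ++ (a :: v') ++ w)
    (b := u ++ (b :: v) ++ w) ⟨⟨u ++ v, w, c, hx, by simp [h1]⟩, ⟨u, v' ++ w, a, by simp [hy], by simp⟩⟩
    ⟨⟨u, v ++ w, b, by simp [hx], by simp⟩, ⟨u ++ v', w, d, hy, by simp [h2]⟩⟩ ?_
  intro h
  simp at h
  exact hab h.1

theorem two_le_ncard_delBall_inter {q n : ℕ} {x y : Word q n} {u v w : List (Fin q)} {a b : Fin q}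
    {v' : List (Fin q)} (hx : List.ofFn x = u ++ a :: b :: v ++ w)
    (hy : List.ofFn y = u ++ b :: a :: v' ++ w)
    (h1 : a :: v' = v ++ [a]) (h2 : b :: v = v' ++ [b]) (hab : a ≠ b) :
    2 ≤ (delBall x ∩ delBall y).ncard := by
  refine two_le_ncard ((delBall_finite x).inter_of_left _) (a := u ++ (a :: v') ++ w)
    (b := u ++ (b :: v) ++ w)
    ⟨⟨u ++ (a :: v'), w, b, ?_, by simp⟩, ⟨u, a :: v' ++ w, b, by simp [hy], by simp⟩⟩
    ⟨⟨u, b :: v ++ w, a, by simp [hx], by simp⟩, ⟨u ++ b :: v, w, a, ?_, by simp⟩⟩ ?_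
  · rw [hx, h2]
    simp
  · rw [hy, h1]
    simp
  · intro h
    simp at h
    exact hab h.1

/-- The word `abab…ab` of length `2 * k`. -/
def altList {α : Type*} (a b : α) : ℕ → List α
  | 0 => []
  | k + 1 => a :: b :: altList a b k

/-- This is what makes `abab…` and `baba…` confusable: each is the other shifted by one place, in
both directions, so they have two common insertions and two common deletions. -/
theorem cons_altList {α : Type*} (a b : α) (k : ℕ) :
    a :: altList b a k = altList a b k ++ [a] := by
  induction k with
  | zero => rfl
  | succ k ih =>
    simp only [altList, List.cons_append]
    rw [← ih]

theorem length_altList {α : Type*} (a b : α) (k : ℕ) : (altList a b k).length = 2 * k := by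
  induction k with
  | zero => rfl
  | succ k ih => simp [altList, ih]; ring

theorem altList_add {α : Type*} (a b : α) (k l : ℕ) :
    altList a b (k + l) = altList a b k ++ altList a b l := by
  induction k with
  | zero => simp [altList]
  | succ k ih => rw [Nat.add_right_comm]; simp [altList, ih]

theorem two_le_ncard_insBall_inter_of_alt {q n k : ℕ} {x y : Word q n} {u w : List (Fin q)}
    {a b : Fin q} (hab : a ≠ b) (hx : List.ofFn x = u ++ altList a b (k + 1) ++ w)
    (hy : List.ofFn y = u ++ altList b a (k + 1) ++ w) : 2 ≤ (insBall x ∩ insBall y).ncard :=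
  two_le_ncard_insBall_inter hx hy (cons_altList a b _) (cons_altList b a _) hab

theorem two_le_ncard_delBall_inter_of_alt {q n k : ℕ} {x y : Word q n} {u w : List (Fin q)}
    {a b : Fin q} (hab : a ≠ b) (hx : List.ofFn x = u ++ altList a b (k + 1) ++ w)
    (hy : List.ofFn y = u ++ altList b a (k + 1) ++ w) : 2 ≤ (delBall x ∩ delBall y).ncard :=
  two_le_ncard_delBall_inter hx hy (cons_altList a b _) (cons_altList b a _) hab

/-- The common words are the `q` substitutions at `i`, the two insertions putting `x i` and `y i`
side by side in either order, and the deletion of position `i`. -/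
theorem le_ncard_editBall_inter_of_one {q n : ℕ} {x y : Word q n} (hne : x ≠ y) {i : Fin n}
    (h : ∀ p, p ≠ i → x p = y p) : q + 3 ≤ (editBall x ∩ editBall y).ncard := by
  have hi : x i ≠ y i := fun hi => hne (funext fun p => by
    by_cases hp : p = i
    · rw [hp, hi]
    · exact h p hp)
  set u := (List.ofFn x).take i
  set v := (List.ofFn x).drop (i + 1)
  have hlx : (i : ℕ) < (List.ofFn x).length := by simp
  have hx : List.ofFn x = u ++ x i :: v := by
    have : x i = (List.ofFn x)[(i : ℕ)] := by simp
    rw [this, List.cons_getElem_drop_succ, List.take_append_drop]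
  have hy : List.ofFn y = u ++ y i :: v := by
    have : y = Function.update x i (y i) := by
      funext p
      by_cases hp : p = i
      · subst hp
        simp
      · simp [hp, h p hp]
    conv_lhs => rw [this]
    rw [ofFn_update, List.set_eq_take_append_cons_drop, if_pos hlx]
  refine le_trans (by omega) (le_ncard_editBall_inter (le_ncard_subBall_inter h) (b := 2) (c := 1) ?_ ?_)
  · exact two_le_ncard_insBall_inter (u := u) (v := [x i]) (v' := [y i]) (w := v) (a := x i)
      (b := y i) (by simp [hx]) (by simp [hy]) rfl rfl hi
  · rw [Nat.one_le_iff_ne_zero, Ne, Set.ncard_eq_zero ((delBall_finite x).inter_of_left _)]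
    exact Set.Nonempty.ne_empty ⟨u ++ v, ⟨u, v, x i, hx, rfl⟩, ⟨u, v, y i, hy, rfl⟩⟩

/-! ### Packing bounds from substitutions -/

theorem card_mul_le_of_injOn {q n : ℕ} {C : Finset (Word q n)} {ι : Type*} [Fintype ι]
    (f : Word q n → ι → Word q n)
    (h : ∀ x ∈ C, ∀ y ∈ C, ∀ a b, f x a = f y b → x = y ∧ a = b) :
    C.card * Fintype.card ι ≤ q ^ n := by
  classical
  calc C.card * Fintype.card ι = (C ×ˢ (Finset.univ : Finset ι)).card := by
        rw [Finset.card_product, Finset.card_univ]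
    _ ≤ (Finset.univ : Finset (Word q n)).card := by
        refine Finset.card_le_card_of_injOn (fun p => f p.1 p.2) (fun _ _ => Finset.mem_univ _) ?_
        rintro ⟨x, a⟩ hx ⟨y, b⟩ hy hxy
        obtain ⟨h1, h2⟩ := h x (Finset.mem_product.1 hx).1 y (Finset.mem_product.1 hy).1 a b hxy
        rw [h1, h2]
    _ = q ^ n := by simp

theorem one_le_rhoEdit {q n N : ℕ} (hq : 2 ≤ q) (hn : 1 ≤ n) (h1 : 1 ≤ N) (h2 : N ≤ q + 3) :
    1 ≤ rhoEdit q n N := by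
  have hq1 : (1 : ℝ) < q := by exact_mod_cast hq
  have hq0 : (0 : ℝ) < q := by positivity
  have := le_rhoEdit (n := n) hq h1 (B := (q : ℝ) ^ n / q) fun C _ hC => by
    rw [le_div_iff₀ hq0]
    let i : Fin n := ⟨0, hn⟩
    have := card_mul_le_of_injOn (C := C) (fun x c => Function.update x i c)
      fun x hx y hy a b hab => by
        refine ⟨?_, ?_⟩
        · by_contra hne
          have h3 := le_ncard_editBall_inter_of_one hne (i := i) fun p hp =>
            eq_of_update_eq_update hab hp hp
          have h4 := hC x hx y hy hne
          omega
        · simpa using congrFun hab i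
    rw [Fintype.card_fin] at this
    exact_mod_cast this
  rw [Real.logb_div (by positivity) (by positivity), Real.logb_pow,
    Real.logb_self_eq_one hq1] at this
  linarith

/-- Incrementing one letter cyclically gives `n` distinct neighbours of each codeword. A neighbour
shared by two codewords would put them at distance at most two, hence give two common substitutions.
-/
theorem logb_le_rhoEdit {q n N : ℕ} (hq : 2 ≤ q) (hn : 1 ≤ n) (h1 : 1 ≤ N) (h2 : N ≤ 2) :
    Real.logb q n ≤ rhoEdit q n N := by
  have hq1 : (1 : ℝ) < q := by exact_mod_cast hq
  have hq0 : (0 : ℝ) < q := by positivity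
  have hn0 : (0 : ℝ) < n := by positivity
  have : NeZero q := ⟨by omega⟩
  have : Fact (1 < q) := ⟨hq⟩
  have := le_rhoEdit (n := n) hq h1 (B := (q : ℝ) ^ n / n) fun C _ hC => by
    rw [le_div_iff₀ hn0]
    have := card_mul_le_of_injOn (C := C) (fun x i => Function.update x i (x i + 1))
      fun x hx y hy i j hab => by
        have hxy : x = y := by
          by_contra hne
          have hij : i ≠ j := by
            rintro rfl
            refine hne (funext fun p => ?_)
            by_cases hp : p = i
            · subst hp
              simpa using congrFun hab p
            · exact eq_of_update_eq_update hab hp hp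
          have h3 := le_ncard_editBall_inter (two_le_ncard_subBall_inter hne hij fun p hp hq =>
            eq_of_update_eq_update hab hp hq) (Nat.zero_le _) (Nat.zero_le _)
          have h4 := hC x hx y hy hne
          omega
        subst hxy
        refine ⟨rfl, ?_⟩
        by_contra hij
        have := congrFun hab i
        rw [Function.update_self, Function.update_of_ne hij] at this
        have h5 : (1 : Fin q) = 0 := by simpa using this
        have := congrArg Fin.val h5
        rw [Fin.val_one', Fin.val_zero, Nat.mod_eq_of_lt hq] at this
        omega
    rw [Fintype.card_fin] at this
    exact_mod_cast this
  rw [Real.logb_div (by positivity) (by positivity), Real.logb_pow,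
    Real.logb_self_eq_one hq1] at this
  linarith

/-! ### The block replacement argument -/

/-- The `b`-th block of `x`, for a family `e` of disjoint blocks of positions. -/
def block {q n L B : ℕ} (e : Fin B × Fin L ↪ Fin n) (x : Word q n) (b : Fin B) : Word q L :=
  fun j => x (e (b, j))

/-- The word `x` with its `b`-th block replaced by `a`. -/
noncomputable def splice {q n L B : ℕ} (e : Fin B × Fin L ↪ Fin n) (x : Word q n) (b : Fin B)
    (a : Word q L) : Word q n :=
  Function.extend (fun j => e (b, j)) a x

theorem block_injective {n L B : ℕ} (e : Fin B × Fin L ↪ Fin n) (b : Fin B) :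
    Function.Injective fun j => e (b, j) := fun i j h => by simpa using h

theorem block_splice_self {q n L B : ℕ} (e : Fin B × Fin L ↪ Fin n) (x : Word q n) (b : Fin B)
    (a : Word q L) : block e (splice e x b a) b = a :=
  funext fun j => (block_injective e b).extend_apply a x j

theorem splice_of_ne {q n L B : ℕ} (e : Fin B × Fin L ↪ Fin n) (x : Word q n) (b : Fin B)
    (a : Word q L) {p : Fin n} (hp : ∀ j, p ≠ e (b, j)) : splice e x b a p = x p :=
  Function.extend_apply' _ _ _ fun ⟨j, hj⟩ => hp j hj.symm

theorem block_splice_of_ne {q n L B : ℕ} (e : Fin B × Fin L ↪ Fin n) (x : Word q n) {b c : Fin B}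
    (a : Word q L) (h : c ≠ b) : block e (splice e x b a) c = block e x c :=
  funext fun j => splice_of_ne e x b a fun i hi => h (by simpa using congrArg Prod.fst (e.injective hi))

/-- `b` is the first block of `x` that belongs to `A`. -/
def IsFirstBlock {q n L B : ℕ} (e : Fin B × Fin L ↪ Fin n) (A : Finset (Word q L)) (x : Word q n)
    (b : Fin B) : Prop :=
  block e x b ∈ A ∧ ∀ c < b, block e x c ∉ A

theorem exists_isFirstBlock {q n L B : ℕ} {e : Fin B × Fin L ↪ Fin n} {A : Finset (Word q L)}
    {x : Word q n} (h : ∃ b, block e x b ∈ A) : ∃ b, IsFirstBlock e A x b := by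
  obtain ⟨b, hb, hmin⟩ := WellFounded.has_min (wellFounded_lt (α := Fin B)) {b | block e x b ∈ A} h
  exact ⟨b, hb, fun c hc h => hmin c h hc⟩

theorem IsFirstBlock.splice {q n L B : ℕ} {e : Fin B × Fin L ↪ Fin n} {A : Finset (Word q L)}
    {x : Word q n} {b : Fin B} (h : IsFirstBlock e A x b) {a : Word q L} (ha : a ∈ A) :
    IsFirstBlock e A (splice e x b a) b := by
  refine ⟨by rwa [block_splice_self], fun c hc => ?_⟩
  rw [block_splice_of_ne e x a hc.ne]
  exact h.2 c hc

theorem IsFirstBlock.unique {q n L B : ℕ} {e : Fin B × Fin L ↪ Fin n} {A : Finset (Word q L)}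
    {x : Word q n} {b c : Fin B} (hb : IsFirstBlock e A x b) (hc : IsFirstBlock e A x c) :
    b = c := by
  rcases lt_trichotomy b c with h | h | h
  · exact absurd hb.1 (hc.2 b h)
  · exact h
  · exact absurd hc.1 (hb.2 c h)

theorem card_le_of_forall_block_notMem {q n L B : ℕ} (e : Fin B × Fin L ↪ Fin n)
    (A : Finset (Word q L)) (C : Finset (Word q n)) (h : ∀ x ∈ C, ∀ b, block e x b ∉ A) :
    C.card ≤ (q ^ L - A.card) ^ B * q ^ (n - B * L) := by
  classical
  have hR : Fintype.card {p : Fin n // p ∉ Set.range e} = n - B * L := by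
    rw [← Nat.card_eq_fintype_card]
    change Nat.card ((Set.range e)ᶜ : Set (Fin n)) = _
    rw [Nat.card_coe_set_eq, Set.ncard_compl, ← Set.image_univ,
      Set.ncard_image_of_injective _ e.injective, Set.ncard_univ]
    simp
  calc C.card ≤ ((Fintype.piFinset fun _ : Fin B => Aᶜ) ×ˢ
        (Finset.univ : Finset ({p : Fin n // p ∉ Set.range e} → Fin q))).card := by
        refine Finset.card_le_card_of_injOn (fun x => (block e x, fun p => x p)) ?_ ?_
        · intro x hx
          simpa using h x hx
        · intro x _ y _ hxy
          funext p
          by_cases hp : p ∈ Set.range e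
          · obtain ⟨⟨b, j⟩, rfl⟩ := hp
            exact congrFun (congrFun (congrArg Prod.fst hxy) b) j
          · exact congrFun (congrArg Prod.snd hxy) ⟨p, hp⟩
    _ = _ := by
        rw [Finset.card_product, Fintype.card_piFinset_const, Finset.card_compl, Finset.card_univ,
          Fintype.card_fun, Fintype.card_fun (β := Fin q), hR, Fintype.card_fin, Fintype.card_fin]

/-- Replace the first block of a codeword that lies in `A` by an arbitrary member of `A`. Its place
is unchanged, so it can be read off the result. Two codewords with the same result would differ only
in that block, with both versions in `A`, which is excluded; so these codewords number at most `q ^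
n / |A|`. The second summand counts the words with no block in `A`. -/
theorem card_mul_card_le_of_blocks {q n L B : ℕ} (e : Fin B × Fin L ↪ Fin n)
    (A : Finset (Word q L)) (C : Finset (Word q n))
    (h : ∀ x ∈ C, ∀ y ∈ C, x ≠ y → ∀ b, (∀ p, (∀ j, p ≠ e (b, j)) → x p = y p) →
      block e x b ∈ A → block e y b ∈ A → False) :
    C.card * A.card ≤ q ^ n + A.card * ((q ^ L - A.card) ^ B * q ^ (n - B * L)) := by
  classical
  set C₁ := C.filter fun x => ∃ b, block e x b ∈ A
  set C₀ := C.filter fun x => ¬ ∃ b, block e x b ∈ A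
  have hC : C.card = C₁.card + C₀.card := (Finset.card_filter_add_card_filter_not _).symm
  have h0 : C₀.card ≤ (q ^ L - A.card) ^ B * q ^ (n - B * L) :=
    card_le_of_forall_block_notMem e A C₀ fun x hx b hb =>
      (Finset.mem_filter.1 hx).2 ⟨b, hb⟩
  have hfirst : ∀ x : C₁, ∃ b, IsFirstBlock e A x.1 b := fun x =>
    exists_isFirstBlock (Finset.mem_filter.1 x.2).2
  choose first hfirst using hfirst
  have h1 := card_mul_le_of_injOn (C := C₁) (ι := A)
    (fun x a => if hx : x ∈ C₁ then splice e x (first ⟨x, hx⟩) a else x)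
    fun x hx y hy a a' hab => by
      rw [dif_pos hx, dif_pos hy] at hab
      have fx := hfirst ⟨x, hx⟩
      have fy := hfirst ⟨y, hy⟩
      have gx := fx.splice a.2
      have gy := fy.splice a'.2
      dsimp only at hab gx gy fx fy
      rw [← hab] at gy
      have hb := gy.unique gx
      rw [hb] at hab fy
      refine ⟨?_, ?_⟩
      · by_contra hne
        refine h x (Finset.mem_filter.1 hx).1 y (Finset.mem_filter.1 hy).1 hne _
          (fun p hp => ?_) fx.1 fy.1
        have := congrFun hab p
        rwa [splice_of_ne e x _ _ hp, splice_of_ne e y _ _ hp] at this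
      · have := congrArg (fun z => block e z (first ⟨x, hx⟩)) hab
        simp only [block_splice_self] at this
        exact Subtype.ext this
  rw [Fintype.card_coe] at h1
  rw [hC, add_mul, mul_comm C₀.card]
  exact Nat.add_le_add h1 (Nat.mul_le_mul_left _ h0)

/-- `B` consecutive blocks of length `L`. -/
def consecutiveBlocks {n L B : ℕ} (h : B * L ≤ n) : Fin B × Fin L ↪ Fin n :=
  finProdFinEquiv.toEmbedding.trans (Fin.castLEEmb h)

theorem consecutiveBlocks_val {n L B : ℕ} (h : B * L ≤ n) (b : Fin B) (j : Fin L) :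
    (consecutiveBlocks h (b, j) : ℕ) = j + L * b := rfl

theorem exists_ofFn_eq_append {q n L B : ℕ} (h : B * L ≤ n) {x y : Word q n} {b : Fin B}
    (hxy : ∀ p, (∀ j, p ≠ consecutiveBlocks h (b, j)) → x p = y p) :
    ∃ u w, List.ofFn x = u ++ List.ofFn (block (consecutiveBlocks h) x b) ++ w ∧
      List.ofFn y = u ++ List.ofFn (block (consecutiveBlocks h) y b) ++ w := by
  have hb : L * b + L ≤ n := by
    have : (b + 1) * L ≤ B * L := Nat.mul_le_mul_right L b.2
    have e : ((b : ℕ) + 1) * L = L * b + L := by ring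
    omega
  have key : ∀ z : Word q n, List.ofFn z = (List.ofFn z).take (L * b) ++
      List.ofFn (block (consecutiveBlocks h) z b) ++ (List.ofFn z).drop (L * b + L) := by
    intro z
    have hm : List.ofFn (block (consecutiveBlocks h) z b) =
        ((List.ofFn z).drop (L * b)).take L := by
      apply List.ext_getElem
      · simp
        omega
      · intro p h1 h2
        simp only [List.getElem_ofFn, List.getElem_take, List.getElem_drop, block]
        congr 1
        ext
        rw [consecutiveBlocks_val]
        simp [add_comm]
    rw [hm, List.append_assoc, ← List.drop_drop, List.take_append_drop, List.take_append_drop]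
  refine ⟨(List.ofFn x).take (L * b), (List.ofFn x).drop (L * b + L), key x, ?_⟩
  have h1 : (List.ofFn x).take (L * b) = (List.ofFn y).take (L * b) := by
    apply List.ext_getElem
    · simp
    · intro p h1 h2
      simp only [List.getElem_take, List.getElem_ofFn]
      refine hxy _ fun j hj => ?_
      have := congrArg Fin.val hj
      rw [consecutiveBlocks_val] at this
      simp at h1 this
      omega
  have h2 : (List.ofFn x).drop (L * b + L) = (List.ofFn y).drop (L * b + L) := by
    apply List.ext_getElem
    · simp
    · intro p h1 h2
      simp only [List.getElem_drop, List.getElem_ofFn]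
      refine hxy _ fun j hj => ?_
      have := congrArg Fin.val hj
      rw [consecutiveBlocks_val] at this
      simp at this
      omega
  rw [h1, h2]
  exact key y

/-! ### Binary codes for `N = 5` and `N = 6`: blocks of length two -/

theorem six_le_ncard_editBall_inter {q n B : ℕ} (h : B * 2 ≤ n) {x y : Word q n} {b : Fin B}
    (hxy : ∀ p, (∀ j, p ≠ consecutiveBlocks h (b, j)) → x p = y p) {c d : Fin q} (hcd : c ≠ d)
    (hx : block (consecutiveBlocks h) x b = ![c, d])
    (hy : block (consecutiveBlocks h) y b = ![d, c]) :
    6 ≤ (editBall x ∩ editBall y).ncard := by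
  have hne : x ≠ y := by
    rintro rfl
    have := congrFun (hx.symm.trans hy) 0
    exact hcd (by simpa using this)
  obtain ⟨u, w, h1, h2⟩ := exists_ofFn_eq_append h hxy
  rw [hx] at h1
  rw [hy] at h2
  have e : ∀ f g : Fin q, List.ofFn ![f, g] = altList f g (0 + 1) := fun f g => by simp [altList]
  rw [e] at h1 h2
  exact le_ncard_editBall_inter (a := 2) (b := 2) (c := 2)
    (two_le_ncard_subBall_inter hne (i := consecutiveBlocks h (b, 0))
      (j := consecutiveBlocks h (b, 1)) (by simp) fun p hp hp' => hxy p fun j => by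
        fin_cases j
        · exact hp
        · exact hp')
    (two_le_ncard_insBall_inter_of_alt hcd h1 h2) (two_le_ncard_delBall_inter_of_alt hcd h1 h2)

theorem ncard_editBall_inter_of_block {q n B : ℕ} (h : B * 2 ≤ n) {x y : Word q n} (hne : x ≠ y)
    {b : Fin B} (hxy : ∀ p, (∀ j, p ≠ consecutiveBlocks h (b, j)) → x p = y p) (j : Fin 2)
    (hj : block (consecutiveBlocks h) x b j = block (consecutiveBlocks h) y b j) :
    q + 3 ≤ (editBall x ∩ editBall y).ncard := by
  refine le_ncard_editBall_inter_of_one hne (i := consecutiveBlocks h (b, j + 1)) fun p hp => ?_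
  by_cases hp' : p = consecutiveBlocks h (b, j)
  · rw [hp']
    exact hj
  · refine hxy p fun i => ?_
    have : i = j ∨ i = j + 1 := by
      omega
    rcases this with rfl | rfl
    · exact hp'
    · exact hp

/-- Two of the blocks `01`, `10`, `11` either agree in a letter, giving at least `q + 3 = 5` common
words, or are transposed, giving at least 6. Only the block `00` avoids this set, so the error term
is bounded. -/
theorem card_mul_three_le {n : ℕ} {C : Finset (Word 2 n)}
    (hC : ∀ x ∈ C, ∀ y ∈ C, x ≠ y → (editBall x ∩ editBall y).ncard < 5) :
    C.card * 3 ≤ 2 ^ n + 6 := by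
  have h : n / 2 * 2 ≤ n := Nat.div_mul_le_self n 2
  have hcard : ({![0, 1], ![1, 0], ![1, 1]} : Finset (Word 2 2)).card = 3 := by decide
  have := card_mul_card_le_of_blocks (consecutiveBlocks h) {![0, 1], ![1, 0], ![1, 1]} C
    fun x hx y hy hne b hxy hbx hby => by
      have h5 := hC x hx y hy hne
      have key : ∀ a ∈ ({![0, 1], ![1, 0], ![1, 1]} : Finset (Word 2 2)),
          ∀ c ∈ ({![0, 1], ![1, 0], ![1, 1]} : Finset (Word 2 2)),
          (∃ j, a j = c j) ∨ (a = ![0, 1] ∧ c = ![1, 0]) ∨ (a = ![1, 0] ∧ c = ![0, 1]) := by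
        decide
      rcases key _ hbx _ hby with ⟨j, hj⟩ | ⟨h1, h2⟩ | ⟨h1, h2⟩
      · have := ncard_editBall_inter_of_block h hne hxy j hj
        omega
      · have := six_le_ncard_editBall_inter h hxy (by decide) h1 h2
        omega
      · have := six_le_ncard_editBall_inter h hxy (by decide) h1 h2
        omega
  rw [hcard] at this
  have h2 : 2 ^ (n - n / 2 * 2) ≤ 2 ^ 1 := Nat.pow_le_pow_right (by omega) (by omega)
  simp at this h2
  omega

theorem card_mul_two_le {n : ℕ} {C : Finset (Word 2 n)}
    (hC : ∀ x ∈ C, ∀ y ∈ C, x ≠ y → (editBall x ∩ editBall y).ncard < 6) :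
    C.card * 2 ≤ 2 ^ n + 2 * 2 ^ (n - n / 2) := by
  have h : n / 2 * 2 ≤ n := Nat.div_mul_le_self n 2
  have hcard : ({![0, 1], ![1, 0]} : Finset (Word 2 2)).card = 2 := by decide
  have := card_mul_card_le_of_blocks (consecutiveBlocks h) {![0, 1], ![1, 0]} C
    fun x hx y hy hne b hxy hbx hby => by
      have h5 := hC x hx y hy hne
      have key : ∀ a ∈ ({![0, 1], ![1, 0]} : Finset (Word 2 2)),
          ∀ c ∈ ({![0, 1], ![1, 0]} : Finset (Word 2 2)),
          a = c ∨ (a = ![0, 1] ∧ c = ![1, 0]) ∨ (a = ![1, 0] ∧ c = ![0, 1]) := by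
        decide
      rcases key _ hbx _ hby with he | ⟨h1, h2⟩ | ⟨h1, h2⟩
      · refine hne (funext fun p => ?_)
        by_cases hp : ∃ j, p = consecutiveBlocks h (b, j)
        · obtain ⟨j, rfl⟩ := hp
          exact congrFun he j
        · exact hxy p fun j hj => hp ⟨j, hj⟩
      · have := six_le_ncard_editBall_inter h hxy (by decide) h1 h2
        omega
      · have := six_le_ncard_editBall_inter h hxy (by decide) h1 h2
        omega
  rw [hcard] at this
  refine this.trans_eq ?_
  have e : (2 ^ 2 - 2) ^ (n / 2) * 2 ^ (n - n / 2 * 2) = 2 ^ (n - n / 2) := by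
    rw [show (2 ^ 2 - 2 : ℕ) = 2 from rfl, ← pow_add]
    congr 1
    omega
  rw [e]

/-! ### Lower bound for `N = 3, 4`: alternating blocks -/

/-- The word `(ab)^i (ba)^(m-i)`. -/
def switchWord {q : ℕ} (a b : Fin q) (m i : ℕ) : Word q (2 * m) := fun j =>
  (altList a b i ++ altList b a (m - i)).getD j a

theorem ofFn_switchWord {q : ℕ} (a b : Fin q) {m i : ℕ} (h : i ≤ m) :
    List.ofFn (switchWord a b m i) = altList a b i ++ altList b a (m - i) := by
  have hl : (altList a b i ++ altList b a (m - i)).length = 2 * m := by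
    rw [List.length_append, length_altList, length_altList]
    omega
  apply List.ext_getElem
  · rw [hl, List.length_ofFn]
  · intro p h1 h2
    -- The default value of `getD` is never used, as the list has length exactly `2 * m` when `i ≤
    -- m`.
    rw [List.getElem_ofFn, switchWord, List.getD_eq_getElem _ _ h2]

theorem exists_switchWord_eq {q : ℕ} (a b : Fin q) {m i j : ℕ} (hij : i < j) (hj : j ≤ m) :
    ∃ u w k, List.ofFn (switchWord a b m i) = u ++ altList b a (k + 1) ++ w ∧
      List.ofFn (switchWord a b m j) = u ++ altList a b (k + 1) ++ w := by
  obtain ⟨k, rfl⟩ : ∃ k, j = i + (k + 1) := ⟨j - i - 1, by omega⟩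
  refine ⟨altList a b i, altList b a (m - (i + (k + 1))), k, ?_, ?_⟩
  · rw [ofFn_switchWord a b (by omega), List.append_assoc, ← altList_add]
    congr 2
    omega
  · rw [ofFn_switchWord a b hj, altList_add]

/-- The `m + 1` switch words differ pairwise by turning one alternating segment into its opposite,
which already gives two common insertions and two common deletions. -/
theorem card_mul_le_of_switch {q n m B : ℕ} (hq : 2 ≤ q) (h : B * (2 * m) ≤ n)
    {C : Finset (Word q n)}
    (hC : ∀ x ∈ C, ∀ y ∈ C, x ≠ y → (editBall x ∩ editBall y).ncard < 4) :
    C.card * (m + 1) ≤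
      q ^ n + (m + 1) * ((q ^ (2 * m) - (m + 1)) ^ B * q ^ (n - B * (2 * m))) := by
  classical
  let c : Fin q := ⟨0, by omega⟩
  let d : Fin q := ⟨1, by omega⟩
  have hcd : c ≠ d := by simp [c, d]
  set A := (Finset.range (m + 1)).image (switchWord c d m) with hA
  have hinj : Set.InjOn (switchWord c d m) (Finset.range (m + 1)) := by
    have aux : ∀ i j, i < j → j ≤ m → switchWord c d m i ≠ switchWord c d m j := by
      intro i j hij hj he
      obtain ⟨u, w, k, h1, h2⟩ := exists_switchWord_eq c d hij hj
      rw [he, h2] at h1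
      simp [altList] at h1
      exact hcd h1.1
    intro i hi j hj hij
    simp at hi hj
    rcases lt_trichotomy i j with hlt | hlt | hlt
    · exact absurd hij (aux i j hlt (by omega))
    · exact hlt
    · exact absurd hij.symm (aux j i hlt (by omega))
  have hcard : A.card = m + 1 := by
    rw [hA, Finset.card_image_of_injOn hinj, Finset.card_range]
  have := card_mul_card_le_of_blocks (consecutiveBlocks h) A C
    fun x hx y hy hne b hxy hbx hby => by
      have aux : ∀ x y : Word q n, (∀ p, (∀ j, p ≠ consecutiveBlocks h (b, j)) → x p = y p) →
          ∀ i j, i < j → j ≤ m → block (consecutiveBlocks h) x b = switchWord c d m i →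
          block (consecutiveBlocks h) y b = switchWord c d m j →
          4 ≤ (editBall x ∩ editBall y).ncard := by
        intro x y hxy i j hij hj hx hy
        obtain ⟨u, w, h1, h2⟩ := exists_ofFn_eq_append h hxy
        obtain ⟨u', w', k, h3, h4⟩ := exists_switchWord_eq c d hij hj
        have h5 : List.ofFn x = (u ++ u') ++ altList d c (k + 1) ++ (w' ++ w) := by
          rw [h1, hx, h3]
          simp
        have h6 : List.ofFn y = (u ++ u') ++ altList c d (k + 1) ++ (w' ++ w) := by
          rw [h2, hy, h4]
          simp
        exact le_ncard_editBall_inter (Nat.zero_le _)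
          (two_le_ncard_insBall_inter_of_alt hcd.symm h5 h6)
          (two_le_ncard_delBall_inter_of_alt hcd.symm h5 h6)
      have h4 := hC x hx y hy hne
      obtain ⟨i, hi, hix⟩ := Finset.mem_image.1 hbx
      obtain ⟨j, hj, hjy⟩ := Finset.mem_image.1 hby
      rw [Finset.mem_range] at hi hj
      rcases lt_trichotomy i j with hlt | hlt | hlt
      · have := aux x y hxy i j hlt (by omega) hix.symm hjy.symm
        omega
      · subst hlt
        refine hne (funext fun p => ?_)
        by_cases hp : ∃ j, p = consecutiveBlocks h (b, j)
        · obtain ⟨k, rfl⟩ := hp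
          exact congrFun (hix.symm.trans hjy) k
        · exact hxy p fun j hj => hp ⟨j, hj⟩
      · have := aux y x (fun p hp => (hxy p hp).symm) j i hlt (by omega) hjy.symm hix.symm
        rw [Set.inter_comm] at this
        omega
  rwa [hcard] at this

/-! ### Upper bound for `N = 3, 4`: words without long windows of period two -/

/-- No window of length `r` of the word `x` is periodic with period two. -/
def NoLongPeriod {q n : ℕ} (r : ℕ) (x : Word q n) : Prop :=
  ∀ i, i + r ≤ n → ∃ p, i ≤ p ∧ p + 2 < i + r ∧ letter x p ≠ letter x (p + 2)

/-- All but the first two letters of the window can be recovered from the rest of the word, so `r -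
2` letters are not free. -/
theorem card_periodic_le {q n r i : ℕ} (h : i + r ≤ n) (S : Finset (Word q n))
    (hS : ∀ x ∈ S, ∀ p, i ≤ p → p + 2 < i + r → letter x p = letter x (p + 2)) :
    S.card ≤ q ^ (n - (r - 2)) := by
  classical
  let W : Finset (Fin n) := Finset.univ.filter fun p => i + 2 ≤ p ∧ (p : ℕ) < i + r
  have hW : W.card = r - 2 := by
    have : W.map Fin.valEmbedding = Finset.Ico (i + 2) (i + r) := by
      ext p
      simp only [W, Finset.mem_map, Finset.mem_filter, Finset.mem_univ, true_and,
        Fin.valEmbedding_apply, Finset.mem_Ico]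
      constructor
      · rintro ⟨a, ha, rfl⟩
        exact ha
      · intro hp
        exact ⟨⟨p, by omega⟩, hp, rfl⟩
    rw [← Finset.card_map Fin.valEmbedding, this, Nat.card_Ico]
    omega
  have hR : Fintype.card {p // p ∈ Wᶜ} = n - (r - 2) := by
    rw [Fintype.card_coe, Finset.card_compl, hW, Fintype.card_fin]
  calc S.card ≤ (Finset.univ : Finset ({p // p ∈ Wᶜ} → Fin q)).card := by
        refine Finset.card_le_card_of_injOn (fun x p => x p) (fun _ _ => Finset.mem_univ _) ?_
        intro x hx y hy hxy
        have key : ∀ p, letter x p = letter y p := by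
          intro p
          induction p using Nat.strong_induction_on with
          | _ p ih =>
            by_cases hp : i + 2 ≤ p ∧ p < i + r
            · obtain ⟨s, rfl⟩ : ∃ s, p = s + 2 := ⟨p - 2, by omega⟩
              rw [← hS x hx s (by omega) hp.2, ← hS y hy s (by omega) hp.2]
              exact ih s (by omega)
            · by_cases hn : p < n
              · rw [letter_of_lt _ hn, letter_of_lt _ hn]
                congr 1
                exact congrFun hxy ⟨⟨p, hn⟩, by simpa [W] using hp⟩
              · rw [letter_of_le _ (not_lt.1 hn), letter_of_le _ (not_lt.1 hn)]
        funext p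
        have := key p
        rw [letter_coe, letter_coe] at this
        exact Option.some.inj this
    _ = _ := by rw [Finset.card_univ, Fintype.card_fun, hR, Fintype.card_fin]

open Classical in
theorem pow_le_two_mul_card_noLongPeriod {q n r : ℕ} (hr : 2 ≤ r)
    (h : 2 * n ≤ q ^ (r - 2)) :
    q ^ n ≤ 2 * (Finset.univ.filter fun x : Word q n => NoLongPeriod r x).card := by
  set bad := Finset.univ.filter fun x : Word q n => ¬ NoLongPeriod r x
  have hsum : (Finset.univ.filter fun x : Word q n => NoLongPeriod r x).card + bad.card = q ^ n := by
    rw [Finset.card_filter_add_card_filter_not]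
    simp
  have hbad : 2 * bad.card ≤ q ^ n := by
    by_cases hrn : r ≤ n
    · let S : ℕ → Finset (Word q n) := fun i => Finset.univ.filter fun x =>
        i + r ≤ n ∧ ∀ p, i ≤ p → p + 2 < i + r → letter x p = letter x (p + 2)
      have h1 : bad ⊆ (Finset.range n).biUnion S := by
        intro x hx
        have hx := (Finset.mem_filter.1 hx).2
        unfold NoLongPeriod at hx
        push Not at hx
        obtain ⟨i, hi, hx⟩ := hx
        simp only [Finset.mem_biUnion, Finset.mem_range, S, Finset.mem_filter, Finset.mem_univ,
          true_and]
        exact ⟨i, by omega, hi, hx⟩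
      have h2 : ∀ i ∈ Finset.range n, (S i).card ≤ q ^ (n - (r - 2)) := by
        intro i _
        by_cases hi : i + r ≤ n
        · exact card_periodic_le hi _ fun x hx => (Finset.mem_filter.1 hx).2.2
        · simp [S, hi]
      calc 2 * bad.card ≤ 2 * (n * q ^ (n - (r - 2))) := by
            refine Nat.mul_le_mul_left _ ((Finset.card_le_card h1).trans ?_)
            simpa using Finset.card_biUnion_le_card_mul _ _ _ h2
        _ = 2 * n * q ^ (n - (r - 2)) := by ring
        _ ≤ q ^ (r - 2) * q ^ (n - (r - 2)) := Nat.mul_le_mul_right _ h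
        _ = q ^ n := by
            rw [← pow_add]
            congr 1
            omega
    · have : bad = ∅ := by
        refine Finset.filter_eq_empty_iff.2 fun x _ hx => hx fun i hi => ?_
        omega
      simp [this]
  omega

theorem Shift.sub_lt_of_period {q n r : ℕ} {x y : Word q n} {i j : Fin n} (h : Shift x y i j)
    (hy : NoLongPeriod r y)
    (hper : ∀ p, (i : ℕ) ≤ p → p + 2 < (j : ℕ) → letter y p = letter y (p + 2)) :
    (j : ℕ) < i + r := by
  by_contra hlt
  have := h.lt
  obtain ⟨p, h1, h2, h3⟩ := hy i (by omega)
  exact h3 (hper p h1 (by omega))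

theorem abs_sum_Ico_le {n : ℕ} {i j : Fin n} (hij : i ≤ j) (f : Fin n → ℤ) {D : ℤ}
    (hD : ∀ p, |f p| ≤ D) : |∑ p ∈ Finset.Ico i j, f p| ≤ ((j : ℤ) - i) * D := by
  have hij' : (i : ℕ) ≤ j := hij
  calc |∑ p ∈ Finset.Ico i j, f p| ≤ ∑ p ∈ Finset.Ico i j, |f p| := Finset.abs_sum_le_sum_abs _ _
    _ ≤ ∑ p ∈ Finset.Ico i j, D := Finset.sum_le_sum fun p _ => hD p
    _ = _ := by rw [Finset.sum_const, Fin.card_Ico, nsmul_eq_mul, Nat.cast_sub hij']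

/-- When `y` takes only the values `x i` and `y i` on the stretch, every term of the moment
difference is 0 or the fixed nonzero number `y i - x i`, so nothing cancels. The stretch is shorter
than `r`, so the total stays below `q * r` in absolute value. -/
theorem Shift.not_dvd_moment_sub {q n r P : ℕ} {x y : Word q n} {i j : Fin n} (h : Shift x y i j)
    (hd : DiffSpan x y i j) (hij : i ≠ j) (hxy : x i = y j)
    (hval : ∀ p, i ≤ p → p < j → y p = x i ∨ y p = y i) (hr : (j : ℕ) < i + r)
    (hP : q * r ≤ P) : ¬ (P : ℤ) ∣ moment letterValue x - moment letterValue y := by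
  intro hdvd
  rw [h.moment_sub _ (congrArg _ hxy)] at hdvd
  have hlt : i < j := lt_of_le_of_ne hd.le hij
  have hq : 0 < q := (x i).pos
  have h0 := Int.eq_zero_of_abs_lt_dvd hdvd (lt_of_le_of_lt
    (abs_sum_Ico_le hd.le _ (D := q) fun p => (letterValue_sub_lt _ _).le) (by
      have h1 : ((j : ℤ) - i) < r := by omega
      calc ((j : ℤ) - i) * q < r * q := by
            apply mul_lt_mul_of_pos_right h1
            exact_mod_cast hq
        _ = ((q * r : ℕ) : ℤ) := by push_cast; ring
        _ ≤ P := by exact_mod_cast hP))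
  have hi : i ∈ Finset.Ico i j := Finset.mem_Ico.2 ⟨le_rfl, hlt⟩
  have hne : letterValue (y i) - letterValue (x i) ≠ 0 := fun h =>
    hd.left (letterValue_injective (sub_eq_zero.1 h)).symm
  have hterm : ∀ p ∈ Finset.Ico i j, letterValue (y p) - letterValue (x i) = 0 ∨
      letterValue (y p) - letterValue (x i) = letterValue (y i) - letterValue (x i) := by
    intro p hp
    rw [Finset.mem_Ico] at hp
    rcases hval p hp.1 hp.2 with h | h
    · left
      rw [h, sub_self]
    · right
      rw [h]
  rcases lt_or_gt_of_ne hne with hneg | hpos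
  · exact absurd h0 (ne_of_lt (Finset.sum_neg' (fun p hp => by
      rcases hterm p hp with h | h <;> omega) ⟨i, hi, hneg⟩))
  · exact absurd h0 (ne_of_gt (Finset.sum_pos' (fun p hp => by
      rcases hterm p hp with h | h <;> omega) ⟨i, hi, hpos⟩))

theorem Shift.eq_of_weightSum {q n m : ℕ} {x y : Word q n} {i j : Fin n} {g : Fin q → ℤ}
    (h : Shift x y i j) (hw : (weightSum g x : ZMod m) = weightSum g y)
    (hg : ∀ a b, (m : ℤ) ∣ g a - g b → a = b) : x i = y j := by
  have := dvd_sub_of_cast_eq hw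
  rw [h.weightSum_sub] at this
  exact hg _ _ this

/-- With no difference strictly inside, the shift relation becomes `y p = y (p + 1)`, so `y` is
constant on the stretch. -/
theorem Shift.letter_eq_of_two {q n : ℕ} {x y : Word q n} {i j : Fin n} (h : Shift x y i j)
    (hm : ∀ p, i < p → p < j → x p = y p) :
    ∀ p, (i : ℕ) ≤ p → p < (j : ℕ) → letter y p = letter y i := by
  intro p hip
  induction p, hip using Nat.le_induction with
  | base => exact fun _ => rfl
  | succ p hip ih =>
    intro hpj
    have hn : p + 1 < n := by omega
    rw [← ih (by omega), h.mid p hip (by omega), letter_of_lt _ hn, letter_of_lt _ hn,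
      hm ⟨p + 1, hn⟩ (show (i : ℕ) < p + 1 by omega) (show p + 1 < (j : ℕ) from hpj)]

/-- Each step to the right exchanges the letters of `x` and `y`, so both words alternate with period
two. -/
theorem Shift.letter_eq_of_symm {q n : ℕ} {x y : Word q n} {i j : Fin n} (h : Shift x y i j)
    (h' : Shift y x i j) :
    ∀ p, (i : ℕ) ≤ p → p < (j : ℕ) →
      (letter y p = letter y i ∧ letter x p = letter x i) ∨
        (letter y p = letter x i ∧ letter x p = letter y i) := by
  intro p hip
  induction p, hip using Nat.le_induction with
  | base => exact fun _ => Or.inl ⟨rfl, rfl⟩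
  | succ p hip ih =>
    intro hpj
    rw [← h.mid p hip (by omega), ← h'.mid p hip (by omega)]
    rcases ih (by omega) with h | h
    · exact Or.inr ⟨h.2, h.1⟩
    · exact Or.inl ⟨h.2, h.1⟩

/-- At distance two a shift needs a constant stretch, and shifts both ways need an alternating one.
Both have period two, hence are short and detected by the moment. What remains is two substitutions
without shifts, or a single direction without substitutions. -/
theorem ncard_editBall_inter_le_two {q n r P : ℕ} {x y : Word q n} (hne : x ≠ y)
    (hx : NoLongPeriod r x) (hy : NoLongPeriod r y) (hP : q * r ≤ P)
    (hw : (weightSum letterValue x : ZMod q) = weightSum letterValue y)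
    (hm : (moment letterValue x : ZMod P) = moment letterValue y) :
    (editBall x ∩ editBall y).ncard ≤ 2 := by
  classical
  obtain ⟨i, j, hd⟩ := exists_diffSpan hne
  have hij := hd.ne_of_weightSum hw fun _ _ => letterValue_eq_of_dvd
  have hboth : ¬ (Shiftable x y ∧ Shiftable y x) := by
    rintro ⟨⟨s, t, h1⟩, ⟨s', t', h2⟩⟩
    obtain ⟨-, -, h1⟩ := h1.restrict hd
    obtain ⟨-, -, h2⟩ := h2.restrict hd.symm
    refine h1.not_dvd_moment_sub hd hij (h1.eq_of_weightSum hw fun _ _ => letterValue_eq_of_dvd)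
      (fun p hip hpj => ?_) (h1.sub_lt_of_period hy fun p hp hp' => ?_) hP (dvd_sub_of_cast_eq hm)
    · have := h1.letter_eq_of_symm h2 p hip hpj
      simp only [letter_coe, Option.some.injEq] at this
      tauto
    · rw [h1.mid p hp (by omega), h2.mid (p + 1) (by omega) (by omega)]
  have htwo : ∀ x y : Word q n, NoLongPeriod r y → DiffSpan x y i j →
      (weightSum letterValue x : ZMod q) = weightSum letterValue y →
      (moment letterValue x : ZMod P) = moment letterValue y →
      (∀ p, i < p → p < j → x p = y p) → ¬ Shiftable x y := by
    rintro x y hy hd hw hm heq ⟨s, t, h1⟩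
    obtain ⟨-, -, h1⟩ := h1.restrict hd
    refine h1.not_dvd_moment_sub hd hij (h1.eq_of_weightSum hw fun _ _ => letterValue_eq_of_dvd)
      (fun p hip hpj => ?_) (h1.sub_lt_of_period hy fun p hp hp' => ?_) hP (dvd_sub_of_cast_eq hm)
    · have := h1.letter_eq_of_two heq p hip hpj
      simp only [letter_coe, Option.some.injEq] at this
      exact Or.inr this
    · rw [h1.letter_eq_of_two heq p hp (by omega), h1.letter_eq_of_two heq (p + 2) (by omega) hp']
  by_cases heq : ∀ p, i < p → p < j → x p = y p
  · have h1 := htwo x y hy hd hw hm heq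
    have h2 := htwo y x hx hd.symm hw.symm hm.symm fun p hp hp' => (heq p hp hp').symm
    have := ncard_editBall_inter_le_of_two hd hij
    simpa [h1, h2] using this
  · have := ncard_editBall_inter_le_of_three hd heq
    rcases not_and_or.1 hboth with h | h <;> rw [if_neg h] at this <;> split_ifs at this <;> omega

theorem rhoEdit_le_of_three {q n N r : ℕ} (hq : 2 ≤ q) (hN : 3 ≤ N) (hr : 2 ≤ r)
    (h : 2 * n ≤ q ^ (r - 2)) : rhoEdit q n N ≤ Real.logb q (2 * (q * (q * r))) := by
  classical
  have : NeZero q := ⟨by omega⟩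
  have : NeZero (q * r) := ⟨by positivity⟩
  have := rhoEdit_le hq (show 1 ≤ N by omega) (fun x : Word q n =>
      ((weightSum letterValue x : ZMod q), (moment letterValue x : ZMod (q * r))))
    (Finset.univ.filter fun x : Word q n => NoLongPeriod r x) (c := 2)
    (by exact_mod_cast pow_le_two_mul_card_noLongPeriod hr h) fun x hx y hy hxy h => by
      have := ncard_editBall_inter_le_two hxy (Finset.mem_filter.1 hx).2 (Finset.mem_filter.1 hy).2
        le_rfl (congrArg Prod.fst h) (congrArg Prod.snd h)
      omega
  simpa [ZMod.card] using this

/-! ### Upper bound for `N = 1, 2`: disjoint balls -/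

theorem dvd_injective {q D : ℕ} {φ : Fin q → ℤ} (hφ : Function.Injective φ)
    (hD : ∀ a b, |φ a - φ b| ≤ D) (a b : Fin q) (h : ((2 * D + 1 : ℕ) : ℤ) ∣ φ a - φ b) :
    a = b := by
  refine hφ (sub_eq_zero.1 (Int.eq_zero_of_abs_lt_dvd h ((hD a b).trans_lt ?_)))
  push_cast
  omega

theorem Shift.sum_eq_zero {q n D : ℕ} {φ : Fin q → ℤ} (hD : ∀ a b, |φ a - φ b| ≤ D)
    {x y : Word q n} {i j : Fin n} (h : Shift x y i j) (hxy : x i = y j)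
    (hm : (moment φ x : ZMod (n * D + 1)) = moment φ y) :
    ∑ p ∈ Finset.Ico i j, (φ (y p) - φ (x i)) = 0 := by
  have hdvd := dvd_sub_of_cast_eq hm
  rw [h.moment_sub _ (congrArg _ hxy)] at hdvd
  refine Int.eq_zero_of_abs_lt_dvd hdvd ((abs_sum_Ico_le h.le _ fun p => hD _ _).trans_lt ?_)
  have : ((j : ℤ) - i) ≤ n := by omega
  push_cast
  have := mul_le_mul_of_nonneg_right this (Int.natCast_nonneg D)
  omega

theorem DiffSpan.exists_between {q n D : ℕ} {φ : Fin q → ℤ} (hφ : Function.Injective φ)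
    (hD : ∀ a b, |φ a - φ b| ≤ D) {x y : Word q n} {i j : Fin n} (hd : DiffSpan x y i j)
    (hij : i ≠ j) (hw : (weightSum φ x : ZMod (2 * D + 1)) = weightSum φ y)
    (hm : (moment φ x : ZMod (n * D + 1)) = moment φ y) :
    ¬ ∀ p, i < p → p < j → x p = y p := by
  intro heq
  have h1 := dvd_sub_of_cast_eq (m := 2 * D + 1) (by exact_mod_cast hw)
  have h2 := dvd_sub_of_cast_eq (m := n * D + 1) (by exact_mod_cast hm)
  rw [hd.weightSum_sub_of_two hij heq] at h1
  rw [hd.moment_sub_of_two hij heq] at h2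
  have b1 := hD (x i) (y i)
  have b2 := hD (x j) (y j)
  -- Two letters change, so the weight sum changes by at most `2 * D`; this is why the modulus is `2
  -- * D + 1`.
  have e := Int.eq_zero_of_abs_lt_dvd h1 (by
    have := abs_add_le (φ (x i) - φ (y i)) (φ (x j) - φ (y j))
    push_cast
    omega)
  have e' : φ (x i) - φ (y i) = -(φ (x j) - φ (y j)) := by omega
  have hlt : (i : ℕ) < j := lt_of_le_of_ne hd.le fun h => hij (Fin.ext h)
  have e2 : (i : ℤ) * (φ (x i) - φ (y i)) + j * (φ (x j) - φ (y j)) =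
      ((j : ℤ) - i) * (φ (x j) - φ (y j)) := by
    rw [e']
    ring
  rw [e2] at h2
  have e3 := Int.eq_zero_of_abs_lt_dvd h2 (by
    rw [abs_mul, abs_of_nonneg (by omega)]
    have h3 : ((j : ℤ) - i) ≤ n := by omega
    have := mul_le_mul h3 b2 (abs_nonneg _) (by omega)
    push_cast
    omega)
  rcases mul_eq_zero.1 e3 with h | h
  · omega
  · exact hd.right (hφ (sub_eq_zero.1 h))

/-- The two residues rule out distances one and two, hence all common substitutions. A shift
survives only if its moment change is exactly zero, since that change is at most `n * D` in absolute
value. `hS` is the remaining task: no two words of `S` are related by such a balanced shift. -/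
theorem ncard_editBall_inter_eq_zero {q n D : ℕ} {φ : Fin q → ℤ} (hφ : Function.Injective φ)
    (hD : ∀ a b, |φ a - φ b| ≤ D) {S : Set (Word q n)}
    (hS : ∀ x ∈ S, ∀ y ∈ S, ∀ i j : Fin n, Shift x y i j → x i = y j → x i ≠ y i →
      ∑ p ∈ Finset.Ico i j, (φ (y p) - φ (x i)) = 0 →
      (∀ g : Fin q → ℤ, moment g x - moment g y = ∑ p ∈ Finset.Ico i j, (g (y p) - g (x i))) →
      False)
    {x y : Word q n} (hx : x ∈ S) (hy : y ∈ S) (hne : x ≠ y)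
    (hw : (weightSum φ x : ZMod (2 * D + 1)) = weightSum φ y)
    (hm : (moment φ x : ZMod (n * D + 1)) = moment φ y) :
    (editBall x ∩ editBall y).ncard = 0 := by
  classical
  obtain ⟨i, j, hd⟩ := exists_diffSpan hne
  have hij : i ≠ j := hd.ne_of_weightSum (m := 2 * D + 1) (by exact_mod_cast hw) (dvd_injective hφ hD)
  have aux : ∀ x ∈ S, ∀ y ∈ S, DiffSpan x y i j →
      (weightSum φ x : ZMod (2 * D + 1)) = weightSum φ y →
      (moment φ x : ZMod (n * D + 1)) = moment φ y → ¬ Shiftable x y := by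
    rintro x hx y hy hd hw hm ⟨s, t, h⟩
    obtain ⟨-, -, h⟩ := h.restrict hd
    have hxy : x i = y j := h.eq_of_weightSum (m := 2 * D + 1) (by exact_mod_cast hw) (dvd_injective hφ hD)
    exact hS x hx y hy i j h hxy hd.left (h.sum_eq_zero hD hxy hm) fun g =>
      h.moment_sub g (congrArg g hxy)
  have h1 := aux x hx y hy hd hw hm
  have h2 := aux y hy x hx hd.symm hw.symm hm.symm
  have := ncard_editBall_inter_le_of_three hd (hd.exists_between hφ hD hij hw hm)
  simpa [h1, h2] using this

theorem Shift.lt_of_ne {q n : ℕ} {x y : Word q n} {i j : Fin n} (h : Shift x y i j)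
    (h1 : x i = y j) (h2 : x i ≠ y i) : i < j :=
  lt_of_le_of_ne h.le fun he => h2 (by rw [h1, ← he])

/-- With two letters the terms `y p - x i` all have the same sign, so a balanced shift has only zero
terms, contradicting `x i ≠ y i`. -/
theorem rhoEdit_two_le {n N : ℕ} (hN : 1 ≤ N) : rhoEdit 2 n N ≤ Real.logb 2 (3 * (n + 1)) := by
  have hD : ∀ a b : Fin 2, |letterValue a - letterValue b| ≤ (1 : ℕ) := by decide
  have := rhoEdit_le le_rfl hN (fun x : Word 2 n => ((weightSum letterValue x : ZMod (2 * 1 + 1)),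
      (moment letterValue x : ZMod (n * 1 + 1)))) Finset.univ (c := 1)
    (by simp) fun x _ y _ hxy h => by
      rw [ncard_editBall_inter_eq_zero (D := 1) letterValue_injective hD (S := Set.univ)
        (fun x _ y _ i j hs h1 h2 h3 _ => ?_) trivial trivial hxy (by exact_mod_cast congrArg Prod.fst h)
        (by exact_mod_cast congrArg Prod.snd h)]
      · exact hN
      have hlt := hs.lt_of_ne h1 h2
      have hi : i ∈ Finset.Ico i j := Finset.mem_Ico.2 ⟨le_rfl, hlt⟩
      have hval : ∀ c : Fin 2, letterValue c = 0 ∨ letterValue c = 1 := by decide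
      have h4 : letterValue (y i) - letterValue (x i) = 0 := by
        rcases hval (x i) with hc | hc
        · refine (Finset.sum_eq_zero_iff_of_nonneg fun p _ => ?_).1 h3 i hi
          rcases hval (y p) with h | h <;> omega
        · refine (Finset.sum_eq_zero_iff_of_nonpos fun p _ => ?_).1 h3 i hi
          rcases hval (y p) with h | h <;> omega
      exact h2 (letterValue_injective (sub_eq_zero.1 h4)).symm
  simpa [ZMod.card] using this

/-- The indicator function of a letter. -/
def letterIndicator {q : ℕ} (c b : Fin q) : ℤ := if b = c then 1 else 0

/-- Every window of `x` of length at least `k` is unbalanced with respect to every letter. -/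
def Unbalanced {q n : ℕ} (φ : Fin q → ℤ) (k : ℕ) (x : Word q n) : Prop :=
  ∀ (i j : Fin n) (a : Fin q), (i : ℕ) + k ≤ j → ∑ p ∈ Finset.Ico i j, (φ (x p) - φ a) ≠ 0

/-- A balanced shift of an unbalanced word spans fewer than `k` positions. For the indicator of the
letter `x i` its moment change lies between `-(j - i)` and 0, so the residue mod `k` forces it to
vanish. All its terms are nonpositive, so `y i = x i`. -/
theorem rhoEdit_le_of_unbalanced {q n N D k : ℕ} (hq : 2 ≤ q) (hN : 1 ≤ N) {φ : Fin q → ℤ}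
    (hφ : Function.Injective φ) (hD : ∀ a b, |φ a - φ b| ≤ D) (hk : 1 ≤ k)
    {G : Finset (Word q n)} (hG : (q : ℝ) ^ n ≤ 2 * G.card) (hU : ∀ x ∈ G, Unbalanced φ k x) :
    rhoEdit q n N ≤ Real.logb q (2 * ((2 * D + 1) * ((n * D + 1) * k ^ q))) := by
  have : NeZero k := ⟨by omega⟩
  have := rhoEdit_le hq hN (fun x : Word q n => ((weightSum φ x : ZMod (2 * D + 1)),
      (moment φ x : ZMod (n * D + 1)), fun c => (moment (letterIndicator c) x : ZMod k))) G hG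
    fun x hx y hy hxy h => by
      have h1 := congrArg Prod.fst h
      have h2 := congrArg (fun p => p.2.1) h
      have h3 := congrArg (fun p => p.2.2) h
      rw [ncard_editBall_inter_eq_zero (D := D) hφ hD
        (S := {z | z ∈ G ∧ ∀ c, (moment (letterIndicator c) z : ZMod k) =
          moment (letterIndicator c) y}) ?_ ⟨hx, congrFun h3⟩ ⟨hy, fun _ => rfl⟩ hxy
        (by exact_mod_cast h1) (by exact_mod_cast h2)]
      · exact hN
      rintro z ⟨hz, hz'⟩ w ⟨hw, hw'⟩ i j hs e1 e2 e3 e4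
      have hlt := hs.lt_of_ne e1 e2
      have hi : i ∈ Finset.Ico i j := Finset.mem_Ico.2 ⟨le_rfl, hlt⟩
      have hjk : (j : ℕ) < i + k := by
        by_contra hge
        exact hU w hw i j (z i) (by omega) e3
      have hdvd := dvd_sub_of_cast_eq ((hz' (z i)).trans (hw' (z i)).symm)
      rw [e4] at hdvd
      have e5 := Int.eq_zero_of_abs_lt_dvd hdvd ((abs_sum_Ico_le hs.le _ (D := 1) fun p => by
        simp only [letterIndicator]
        split_ifs <;> simp).trans_lt (by omega))
      have e6 := (Finset.sum_eq_zero_iff_of_nonpos fun p _ => by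
        simp only [letterIndicator]
        split_ifs <;> simp).1 e5 i hi
      simp only [letterIndicator, if_true] at e6
      split_ifs at e6 with h
      · exact e2 h.symm
      · omega
  simpa [ZMod.card] using this

/-! ### Most words have no long balanced window -/

/-- At `t = 0` the sum equals the cardinality and has derivative `∑ g ≠ 0`, so 0 is not a minimum.
-/
theorem exists_sum_exp_lt {ι : Type*} [Fintype ι] (g : ι → ℝ) (hg : ∑ c, g c ≠ 0) :
    ∃ t : ℝ, ∑ c, Real.exp (t * g c) < Fintype.card ι := by
  by_contra! h
  have hmin : IsLocalMin (fun t : ℝ => ∑ c, Real.exp (t * g c)) 0 :=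
    Filter.Eventually.of_forall fun t => by simpa using h t
  have hder : HasDerivAt (fun t : ℝ => ∑ c, Real.exp (t * g c)) (∑ c, g c) 0 := by
    have := HasDerivAt.fun_sum (u := Finset.univ) (x := (0 : ℝ))
      (A := fun c (t : ℝ) => Real.exp (t * g c)) (A' := g) fun c _ => by
        simpa using ((hasDerivAt_id (0 : ℝ)).mul_const (g c)).exp
    exact this
  exact hg (hmin.hasDerivAt_eq_zero hder)

/-- Exponential moment bound for the number of words with a balanced set of positions. -/
theorem card_balanced_le {q n : ℕ} (hq : 0 < q) (g : Fin q → ℝ) (t : ℝ) (W : Finset (Fin n))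
    (S : Finset (Word q n)) (hS : ∀ x ∈ S, ∑ p ∈ W, g (x p) = 0) :
    (S.card : ℝ) ≤ (q : ℝ) ^ n * ((∑ c, Real.exp (t * g c)) / q) ^ W.card := by
  classical
  have hq0 : (q : ℝ) ≠ 0 := by positivity
  let h : Fin n → Fin q → ℝ := fun p c => if p ∈ W then Real.exp (t * g c) else 1
  have hprod : ∀ x : Word q n, ∏ p, h p (x p) = Real.exp (t * ∑ p ∈ W, g (x p)) := by
    intro x
    rw [Finset.mul_sum, Real.exp_sum, Finset.prod_ite_mem, Finset.univ_inter]
  calc (S.card : ℝ) = ∑ x ∈ S, ∏ p, h p (x p) := by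
        rw [Finset.sum_congr rfl fun x hx => by rw [hprod x, hS x hx, mul_zero, Real.exp_zero]]
        simp
    _ ≤ ∑ x : Word q n, ∏ p, h p (x p) :=
        Finset.sum_le_sum_of_subset_of_nonneg (Finset.subset_univ _) fun x _ _ => by
          rw [hprod]
          positivity
    _ = ∏ p, ∑ c, h p c := by
        rw [Finset.prod_univ_sum, Fintype.piFinset_univ]
    _ = ∏ p : Fin n, (q : ℝ) * (if p ∈ W then (∑ c, Real.exp (t * g c)) / q else 1) := by
        refine Finset.prod_congr rfl fun p _ => ?_
        by_cases hp : p ∈ W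
        · simp only [h, hp, if_true]
          rw [mul_div_cancel₀ _ hq0]
        · simp [h, hp]
    _ = _ := by
        rw [Finset.prod_mul_distrib, Finset.prod_ite_mem, Finset.univ_inter]
        simp [div_pow]

theorem exists_card_balanced_le {q : ℕ} (hq : 0 < q) (φ : Fin q → ℤ)
    (hφ : ∀ a, ∑ c, (φ c - φ a) ≠ 0) :
    ∃ ρ : ℝ, 0 ≤ ρ ∧ ρ < 1 ∧ ∀ (n : ℕ) (a : Fin q) (W : Finset (Fin n)) (S : Finset (Word q n)),
      (∀ x ∈ S, ∑ p ∈ W, (φ (x p) - φ a) = 0) → (S.card : ℝ) ≤ (q : ℝ) ^ n * ρ ^ W.card := by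
  have hq0 : (0 : ℝ) < q := by positivity
  have : Nonempty (Fin q) := ⟨⟨0, hq⟩⟩
  have h1 : ∀ a, ∃ t : ℝ, ∑ c, Real.exp (t * ((φ c - φ a : ℤ) : ℝ)) < q := by
    intro a
    have := exists_sum_exp_lt (fun c => ((φ c - φ a : ℤ) : ℝ)) (by exact_mod_cast hφ a)
    simpa using this
  choose t ht using h1
  obtain ⟨a₀, ha₀⟩ := Finite.exists_max fun a => (∑ c, Real.exp (t a * ((φ c - φ a : ℤ) : ℝ))) / q
  refine ⟨_, by positivity, (div_lt_one hq0).2 (ht a₀), fun n a W S hS => ?_⟩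
  refine (card_balanced_le hq (fun c => ((φ c - φ a : ℤ) : ℝ)) (t a) W S fun x hx => ?_).trans ?_
  · exact_mod_cast hS x hx
  · have := ha₀ a
    gcongr

open Classical in
theorem exists_pow_le_two_mul_card_unbalanced {q : ℕ} (hq : 0 < q) (φ : Fin q → ℤ)
    (hφ : ∀ a, ∑ c, (φ c - φ a) ≠ 0) : ∃ K : ℕ, 1 ≤ K ∧ ∀ n : ℕ,
      (q : ℝ) ^ n ≤ 2 * ((Finset.univ.filter fun x : Word q n =>
        Unbalanced φ (K * (Nat.log 2 n + 1)) x).card : ℝ) := by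
  have hq0 : (0 : ℝ) < q := by positivity
  have hq1 : (1 : ℝ) ≤ q := by exact_mod_cast hq
  obtain ⟨ρ, h0, h1, hρ⟩ := exists_card_balanced_le hq φ hφ
  -- In the union bound `8 * q` is split as `4 * (2 * q)`. As `n ≤ 2 ^ L`, the factor `4 ^ L` pays
  -- for the pairs of endpoints, and `(2 * q) ^ L ≥ 2 * q` pays for the letters and the final factor
  -- one half.
  obtain ⟨K, hK⟩ := exists_pow_lt_of_lt_one (show (0 : ℝ) < 1 / (8 * q) by positivity) h1
  have hK1 : 1 ≤ K := by
    by_contra h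
    have hK0 : K = 0 := by omega
    rw [hK0, pow_zero, lt_div_iff₀ (by positivity)] at hK
    linarith
  refine ⟨K, hK1, fun n => ?_⟩
  set L := Nat.log 2 n + 1 with hL
  set k := K * L with hk
  set bad := Finset.univ.filter fun x : Word q n => ¬ Unbalanced φ k x
  have hsum : ((Finset.univ.filter fun x : Word q n => Unbalanced φ k x).card : ℝ) + bad.card =
      (q : ℝ) ^ n := by
    have := Finset.card_filter_add_card_filter_not (s := (Finset.univ : Finset (Word q n)))
      (fun x : Word q n => Unbalanced φ k x)
    rw [Finset.card_univ, Fintype.card_fun, Fintype.card_fin, Fintype.card_fin] at this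
    exact_mod_cast this
  let S : Fin n × Fin n × Fin q → Finset (Word q n) := fun w => Finset.univ.filter fun x =>
    (w.1 : ℕ) + k ≤ w.2.1 ∧ ∑ p ∈ Finset.Ico w.1 w.2.1, (φ (x p) - φ w.2.2) = 0
  have hS : ∀ w, ((S w).card : ℝ) ≤ (q : ℝ) ^ n * ρ ^ k := by
    rintro ⟨i, j, a⟩
    by_cases hij : (i : ℕ) + k ≤ j
    · refine (hρ n a (Finset.Ico i j) _ fun x hx => (Finset.mem_filter.1 hx).2.2).trans ?_
      rw [Fin.card_Ico]
      exact mul_le_mul_of_nonneg_left (pow_le_pow_of_le_one h0 h1.le (by omega)) (by positivity)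
    · have : S (i, j, a) = ∅ := Finset.filter_eq_empty_iff.2 fun x _ h => hij h.1
      rw [this]
      simp only [Finset.card_empty, Nat.cast_zero]
      positivity
  have hbad : bad ⊆ Finset.univ.biUnion S := by
    intro x hx
    have hx := (Finset.mem_filter.1 hx).2
    unfold Unbalanced at hx
    push Not at hx
    obtain ⟨i, j, a, hij, hx⟩ := hx
    exact Finset.mem_biUnion.2 ⟨(i, j, a), Finset.mem_univ _,
      Finset.mem_filter.2 ⟨Finset.mem_univ _, hij, hx⟩⟩
  have hcard : (bad.card : ℝ) ≤ (n * (n * q)) * ((q : ℝ) ^ n * ρ ^ k) := by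
    calc (bad.card : ℝ) ≤ ∑ w, ((S w).card : ℝ) := by
          exact_mod_cast (Finset.card_le_card hbad).trans Finset.card_biUnion_le
      _ ≤ ∑ w : Fin n × Fin n × Fin q, (q : ℝ) ^ n * ρ ^ k := Finset.sum_le_sum fun w _ => hS w
      _ = _ := by simp
  have hn : (n : ℝ) ≤ 2 ^ L := by exact_mod_cast (Nat.lt_pow_succ_log_self one_lt_two n).le
  have hρk : ρ ^ k ≤ 1 / (4 ^ L * (2 * q)) := by
    calc ρ ^ k = (ρ ^ K) ^ L := by rw [hk, pow_mul]
      _ ≤ (1 / (8 * q)) ^ L := pow_le_pow_left₀ (by positivity) hK.le _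
      _ = 1 / (4 ^ L * (2 * q) ^ L) := by
          rw [one_div_pow, ← mul_pow]
          congr 2
          ring
      _ ≤ 1 / (4 ^ L * (2 * q)) := by
          have : (2 * q : ℝ) ≤ (2 * q) ^ L := le_self_pow₀ (by linarith) (by omega)
          gcongr
  have hfin : (n * (n * q)) * ρ ^ k ≤ 1 / 2 := by
    calc (n * (n * q)) * ρ ^ k ≤ (2 ^ L * (2 ^ L * q)) * (1 / (4 ^ L * (2 * q))) := by gcongr
      _ = 1 / 2 := by
          rw [show (4 : ℝ) = 2 * 2 by norm_num, mul_pow]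
          field_simp
  have : (bad.card : ℝ) ≤ 1 / 2 * (q : ℝ) ^ n := by
    calc (bad.card : ℝ) ≤ (n * (n * q)) * ((q : ℝ) ^ n * ρ ^ k) := hcard
      _ = ((n * (n * q)) * ρ ^ k) * (q : ℝ) ^ n := by ring
      _ ≤ 1 / 2 * (q : ℝ) ^ n := by gcongr
  linarith

/-- An injective weight whose mean over the alphabet is not an integer. -/
def spreadWeight {q : ℕ} (c : Fin q) : ℤ := q * (c : ℕ) + if (c : ℕ) = 0 then 1 else 0

theorem spreadWeight_injective {q : ℕ} (hq : 2 ≤ q) : Function.Injective (spreadWeight (q := q)) := by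
  intro a b h
  have key : ∀ c : Fin q, ((c : ℕ) : ℤ) = spreadWeight c / q := by
    intro c
    rw [spreadWeight, Int.mul_add_ediv_left _ _ (by omega)]
    split_ifs
    · rw [Int.ediv_eq_zero_of_lt] <;> omega
    · simp
  refine Fin.ext ?_
  have := (key a).trans ((congrArg (fun z => z / (q : ℤ)) h).trans (key b).symm)
  exact_mod_cast this

theorem spreadWeight_sub_le {q : ℕ} (hq : 2 ≤ q) (a b : Fin q) :
    |spreadWeight a - spreadWeight b| ≤ (q * q : ℕ) := by
  have key : ∀ c : Fin q, 0 ≤ spreadWeight c ∧ spreadWeight c ≤ (q * q : ℕ) := by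
    intro c
    have h1 : ((c : ℕ) : ℤ) + 1 ≤ q := by exact_mod_cast c.2
    have h2 : (q : ℤ) * (c : ℕ) + q ≤ q * q := by nlinarith
    have h3 : (0 : ℤ) ≤ q * (c : ℕ) := by positivity
    simp only [spreadWeight]
    push_cast
    split_ifs <;> constructor <;> linarith [(by exact_mod_cast hq : (2 : ℤ) ≤ q)]
  have := key a
  have := key b
  rw [abs_le]
  constructor <;> linarith

/-- The total weight is 1 mod `q`, so it is not `q` times a weight. Plain letter values would fail
for odd `q`, where their mean is itself a letter value. -/
theorem sum_spreadWeight_sub_ne_zero {q : ℕ} (hq : 2 ≤ q) (a : Fin q) :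
    ∑ c : Fin q, (spreadWeight c - spreadWeight a) ≠ 0 := by
  intro h
  have h1 : ∑ c : Fin q, (if (c : ℕ) = 0 then (1 : ℤ) else 0) = 1 := by
    rw [Finset.sum_eq_single ⟨0, by omega⟩]
    · simp
    · intro b _ hb
      rw [if_neg fun h => hb (Fin.ext h)]
    · simp
  have h2 : ∑ c : Fin q, spreadWeight c = q * (∑ c : Fin q, ((c : ℕ) : ℤ)) + 1 := by
    simp only [spreadWeight]
    rw [Finset.sum_add_distrib, h1, Finset.mul_sum]
  rw [Finset.sum_sub_distrib, h2, Finset.sum_const, Finset.card_univ, Fintype.card_fin,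
    nsmul_eq_mul] at h
  have h3 : (q : ℤ) ∣ 1 := ⟨spreadWeight a - ∑ c : Fin q, ((c : ℕ) : ℤ), by linarith⟩
  have := Int.le_of_dvd one_pos h3
  omega

theorem exists_rhoEdit_le {q : ℕ} (hq : 2 ≤ q) : ∃ K : ℕ, 1 ≤ K ∧ ∀ n N : ℕ, 1 ≤ N →
    rhoEdit q n N ≤ Real.logb q (2 * ((2 * ((q * q : ℕ) : ℝ) + 1) * ((n * ((q * q : ℕ) : ℝ) + 1) *
      ((K * (Nat.log 2 n + 1) : ℕ) : ℝ) ^ q))) := by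
  classical
  obtain ⟨K, hK, h⟩ := exists_pow_le_two_mul_card_unbalanced (show 0 < q by omega)
    spreadWeight (sum_spreadWeight_sub_ne_zero hq)
  exact ⟨K, hK, fun n N hN => rhoEdit_le_of_unbalanced hq hN (spreadWeight_injective hq)
    (spreadWeight_sub_le hq) (Nat.mul_pos hK (Nat.succ_pos _)) (h n)
    fun x hx => (Finset.mem_filter.1 hx).2⟩

/-! ### Asymptotics -/

/-- `(1 - A / Q) ^ B ≤ exp (-A)` as soon as `B ≥ Q`, and `A * exp (-A) ≤ 1`. This makes the words
without a switch block negligible. -/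
theorem mul_sub_pow_le_pow {A Q B : ℕ} (hA : A ≤ Q) (hQ : 0 < Q) (hB : Q ≤ B) :
    A * (Q - A) ^ B ≤ Q ^ B := by
  have hQ0 : (0 : ℝ) < Q := by exact_mod_cast hQ
  have h1 : ((Q - A : ℕ) : ℝ) = Q * (1 - A / Q) := by
    rw [Nat.cast_sub hA]
    field_simp
  have h2 : (0 : ℝ) ≤ 1 - A / Q := by
    rw [sub_nonneg, div_le_one hQ0]
    exact_mod_cast hA
  have h3 : (1 - A / Q : ℝ) ^ B ≤ Real.exp (-A) := by
    calc (1 - A / Q : ℝ) ^ B ≤ Real.exp (-(A / Q)) ^ B := by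
          refine pow_le_pow_left₀ h2 ?_ _
          have := Real.add_one_le_exp (-(A / Q : ℝ))
          linarith
      _ = Real.exp (-(A * (B / Q))) := by
          rw [← Real.exp_nat_mul]
          congr 1
          ring
      _ ≤ Real.exp (-A) := by
          have : (1 : ℝ) ≤ B / Q := by
            rw [le_div_iff₀ hQ0, one_mul]
            exact_mod_cast hB
          have := mul_le_mul_of_nonneg_left this (Nat.cast_nonneg (α := ℝ) A)
          gcongr
          linarith
  have h4 : (A : ℝ) * Real.exp (-A) ≤ 1 := by
    rw [Real.exp_neg, ← div_eq_mul_inv, div_le_one (Real.exp_pos _)]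
    linarith [Real.add_one_le_exp (A : ℝ)]
  have : (A : ℝ) * ((Q - A : ℕ) : ℝ) ^ B ≤ (Q : ℝ) ^ B := by
    rw [h1, mul_pow]
    calc (A : ℝ) * (Q ^ B * (1 - A / Q) ^ B) ≤ A * (Q ^ B * Real.exp (-A)) := by gcongr
      _ = Q ^ B * (A * Real.exp (-A)) := by ring
      _ ≤ Q ^ B * 1 := by gcongr
      _ = Q ^ B := mul_one _
  exact_mod_cast this

theorem le_rhoEdit_of_switch {q n m N : ℕ} (hq : 2 ≤ q) (hN : 1 ≤ N) (hN4 : N ≤ 4) (hm : 1 ≤ m)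
    (h : q ^ (4 * m) ≤ n) : Real.logb q ((m + 1) / 2) ≤ rhoEdit q n N := by
  have hq1 : (1 : ℝ) < q := by exact_mod_cast hq
  have hq0 : (0 : ℝ) < q := by positivity
  have := le_rhoEdit (n := n) hq hN (B := (q : ℝ) ^ n / ((m + 1) / 2)) fun C _ hC => by
    rw [le_div_iff₀ (by positivity)]
    have hB : n / (2 * m) * (2 * m) ≤ n := Nat.div_mul_le_self _ _
    have h1 := card_mul_le_of_switch hq hB fun x hx y hy hne => (hC x hx y hy hne).trans_le hN4
    have h2 : 2 * m < q ^ (2 * m) := Nat.lt_pow_self hq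
    -- There are at least as many blocks as words of block length `2 * m`; this is where `q ^ (4 *
    -- m) ≤ n` is needed.
    have h3 : q ^ (2 * m) ≤ n / (2 * m) := by
      rw [Nat.le_div_iff_mul_le (by omega)]
      calc q ^ (2 * m) * (2 * m) ≤ q ^ (2 * m) * q ^ (2 * m) := Nat.mul_le_mul_left _ h2.le
        _ = q ^ (4 * m) := by
            rw [← pow_add]
            congr 1
            omega
        _ ≤ n := h
    have h4 := mul_sub_pow_le_pow (show m + 1 ≤ q ^ (2 * m) by omega) (by positivity) h3
    have h5 : (m + 1) * ((q ^ (2 * m) - (m + 1)) ^ (n / (2 * m)) * q ^ (n - n / (2 * m) * (2 * m))) ≤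
        q ^ n := by
      calc _ = (m + 1) * (q ^ (2 * m) - (m + 1)) ^ (n / (2 * m)) *
            q ^ (n - n / (2 * m) * (2 * m)) := by ring
        _ ≤ (q ^ (2 * m)) ^ (n / (2 * m)) * q ^ (n - n / (2 * m) * (2 * m)) :=
            Nat.mul_le_mul_right _ h4
        _ = q ^ n := by
            rw [← pow_mul, ← pow_add, mul_comm (2 * m)]
            congr 1
            omega
    have h6 : C.card * (m + 1) ≤ 2 * q ^ n := by omega
    have h7 : (C.card : ℝ) * (m + 1) ≤ 2 * (q : ℝ) ^ n := by exact_mod_cast h6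
    linarith
  rw [Real.logb_div (by positivity) (by positivity), Real.logb_pow,
    Real.logb_self_eq_one hq1] at this
  linarith

theorem tendsto_logb_natCast_atTop {q : ℕ} (hq : 2 ≤ q) :
    Tendsto (fun n : ℕ => Real.logb q n) atTop atTop :=
  (Real.tendsto_logb_atTop (by exact_mod_cast hq)).comp tendsto_natCast_atTop_atTop

theorem rhoEdit_two_sub_isBigO {N : ℕ} (h1 : 1 ≤ N) (h2 : N ≤ 2) :
    (fun n : ℕ => rhoEdit 2 n N - Real.logb 2 n) =O[atTop] (fun _ => (1 : ℝ)) := by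
  refine IsBigO.of_bound (Real.logb 2 6) ?_
  filter_upwards [eventually_ge_atTop 1] with n hn
  have hn1 : (1 : ℝ) ≤ n := by exact_mod_cast hn
  have hl := logb_le_rhoEdit (q := 2) le_rfl hn h1 h2
  have hu := rhoEdit_two_le (n := n) h1
  have h3 : Real.logb 2 (3 * (n + 1)) ≤ Real.logb 2 (6 * n) :=
    Real.logb_le_logb_of_le (by norm_num) (by positivity) (by linarith)
  rw [Real.logb_mul (x := 6) (by norm_num) (by positivity)] at h3
  push_cast at hl
  rw [Real.norm_of_nonneg (by linarith), norm_one, mul_one]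
  linarith

theorem rhoEdit_sub_isBigO {q N : ℕ} (hq : 2 ≤ q) (h1 : 1 ≤ N) (h2 : N ≤ 2) :
    (fun n : ℕ => rhoEdit q n N - Real.logb q n)
      =O[atTop] (fun n : ℕ => Real.logb q (Real.logb q n)) := by
  have hq1 : (1 : ℝ) < q := by exact_mod_cast hq
  have hq0 : (0 : ℝ) < q := by positivity
  obtain ⟨K, hK, hρ⟩ := exists_rhoEdit_le hq
  set D : ℝ := ((q * q : ℕ) : ℝ) with hD
  have hD0 : 0 ≤ D := Nat.cast_nonneg _
  set b : ℝ := Real.logb 2 q + 1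
  have hb : 0 < b := by
    have : 0 ≤ Real.logb 2 q := Real.logb_nonneg (by norm_num) hq1.le
    linarith
  -- `M` gathers all constants. Once `log_q n ≥ M` it is absorbed into one extra power of `log_q n`,
  -- whence the exponent `q + 1`.
  set M : ℝ := 2 * ((2 * D + 1) * ((D + 1) * (K * b) ^ q))
  have hM : 0 < M := by positivity
  refine IsBigO.of_bound (q + 1) ?_
  filter_upwards [eventually_ge_atTop 1,
    (tendsto_logb_natCast_atTop hq).eventually_ge_atTop 1,
    (tendsto_logb_natCast_atTop hq).eventually_ge_atTop M] with n hn hl1 hlM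
  set l := Real.logb q n with hldef
  have hn1 : (1 : ℝ) ≤ n := by exact_mod_cast hn
  have hn0 : (0 : ℝ) < n := by linarith
  have hl0 : 0 < l := by linarith
  have hlow := logb_le_rhoEdit hq hn h1 h2
  have hup := hρ n N h1
  have hlog : ((Nat.log 2 n + 1 : ℕ) : ℝ) ≤ b * l := by
    have e1 : (Nat.log 2 n : ℝ) ≤ Real.logb 2 n := Real.natLog_le_logb n 2
    have e2 : Real.logb 2 n = Real.logb 2 q * l := by
      rw [hldef, Real.mul_logb (by positivity) (by linarith) (by linarith)]
    push_cast
    simp only [b]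
    linarith
  have harg : 2 * ((2 * D + 1) * ((n * D + 1) * ((K * (Nat.log 2 n + 1) : ℕ) : ℝ) ^ q)) ≤
      n * l ^ (q + 1) := by
    calc 2 * ((2 * D + 1) * ((n * D + 1) * ((K * (Nat.log 2 n + 1) : ℕ) : ℝ) ^ q))
        ≤ 2 * ((2 * D + 1) * ((n * (D + 1)) * (K * (b * l)) ^ q)) := by
          rw [Nat.cast_mul]
          have : n * D + 1 ≤ n * (D + 1) := by linarith
          gcongr
      _ = n * (M * l ^ q) := by
          rw [← mul_assoc (K : ℝ), mul_pow _ l]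
          simp only [M]
          ring
      _ ≤ n * (l * l ^ q) := by gcongr
      _ = n * l ^ (q + 1) := by ring
  have hup2 : rhoEdit q n N ≤ l + (q + 1) * Real.logb q l := by
    refine hup.trans ((Real.logb_le_logb_of_le hq1 ?_ harg).trans_eq ?_)
    · have : 0 < K * (Nat.log 2 n + 1) := Nat.mul_pos hK (Nat.succ_pos _)
      positivity
    · rw [Real.logb_mul hn0.ne' (by positivity), Real.logb_pow]
      push_cast
      rfl
  rw [Real.norm_of_nonneg (by linarith), Real.norm_of_nonneg (Real.logb_nonneg hq1 hl1)]
  linarith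

theorem rhoEdit_sub_logb_logb_isBigO {q N : ℕ} (hq : 2 ≤ q) (h3 : 3 ≤ N) (h4 : N ≤ 4) :
    (fun n : ℕ => rhoEdit q n N - Real.logb q (Real.logb q n)) =O[atTop] (fun _ => (1 : ℝ)) := by
  have hq1 : (1 : ℝ) < q := by exact_mod_cast hq
  have hq0 : (0 : ℝ) < q := by positivity
  refine IsBigO.of_bound (Real.logb q (10 * q ^ 2) + Real.logb q 8) ?_
  filter_upwards [eventually_ge_atTop (q ^ 4),
    (tendsto_logb_natCast_atTop hq).eventually_ge_atTop 1] with n hn hl1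
  set l := Real.logb q n with hldef
  have hn1 : 1 ≤ n := (Nat.one_le_pow 4 q (by omega)).trans hn
  have hn0 : (0 : ℝ) < n := by exact_mod_cast hn1
  have hl0 : 0 < l := by linarith
  have hup : rhoEdit q n N ≤ Real.logb q (10 * q ^ 2) + Real.logb q l := by
    -- This choice makes `r - 2 = Nat.log q (2 * n) + 1`, an exponent with `q ^ (r - 2) > 2 * n`.
    have h5 := rhoEdit_le_of_three (n := n) (r := Nat.log q (2 * n) + 3) hq h3 (by omega) (by
      exact (Nat.lt_pow_succ_log_self hq (2 * n)).le)
    have h6 : (Nat.log q (2 * n) : ℝ) ≤ l + 1 := by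
      have e1 := Real.natLog_le_logb (2 * n) q
      push_cast at e1
      rw [Real.logb_mul (by norm_num) hn0.ne'] at e1
      have e2 : Real.logb q 2 ≤ 1 := by
        rw [Real.logb_le_iff_le_rpow hq1 (by norm_num), Real.rpow_one]
        exact_mod_cast hq
      linarith
    rw [← Real.logb_mul (by positivity) hl0.ne']
    refine h5.trans (Real.logb_le_logb_of_le hq1 (by positivity) ?_)
    push_cast
    have h7 : (Nat.log q (2 * n) : ℝ) + 3 ≤ 5 * l := by linarith
    calc 2 * ((q : ℝ) * (q * (Nat.log q (2 * n) + 3))) ≤ 2 * (q * (q * (5 * l))) := by gcongr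
      _ = 10 * q ^ 2 * l := by ring
  have hlow : Real.logb q l - Real.logb q 8 ≤ rhoEdit q n N := by
    -- This is the largest `m` for which `q ^ (4 * m) ≤ n`; the threshold `q ^ 4 ≤ n` ensures `m ≥
    -- 1`.
    set m := Nat.log q n / 4 with hm
    have h5 : 4 ≤ Nat.log q n := Nat.le_log_of_pow_le hq hn
    have h6 : q ^ (4 * m) ≤ n :=
      (Nat.pow_le_pow_right (by omega) (by omega)).trans (Nat.pow_log_le_self q (by omega))
    have h7 := le_rhoEdit_of_switch hq (by omega) h4 (show 1 ≤ m by omega) h6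
    refine le_trans ?_ h7
    rw [← Real.logb_div hl0.ne' (by norm_num)]
    refine Real.logb_le_logb_of_le hq1 (by positivity) ?_
    have h8 : l ≤ Nat.log q n + 1 := by
      rw [hldef, Real.logb_le_iff_le_rpow hq1 hn0]
      have := (Nat.lt_pow_succ_log_self hq n).le
      rw [← Nat.cast_succ, Real.rpow_natCast]
      exact_mod_cast this
    have h9 : (Nat.log q n : ℝ) + 1 ≤ 4 * (m + 1) := by
      have : Nat.log q n + 1 ≤ 4 * (m + 1) := by omega
      exact_mod_cast this
    linarith
  have h8 : 0 ≤ Real.logb q 8 := Real.logb_nonneg hq1 (by norm_num)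
  have h10 : 0 ≤ Real.logb q (10 * q ^ 2) := Real.logb_nonneg hq1 (by nlinarith)
  rw [norm_one, mul_one, Real.norm_eq_abs, abs_le]
  constructor <;> linarith

theorem exists_rhoEdit_two_five : ∃ ε δ : ℕ → ℝ, Tendsto δ atTop (𝓝 0) ∧
    ∀ n : ℕ, 1 ≤ n →
      rhoEdit 2 n 5 = 2 - ε n ∧ 0 ≤ ε n ∧ ε n ≤ Real.logb 2 (4 / 3) - δ n := by
  -- The error term is the logarithm of `(2 ^ n + 6) / 2 ^ n`, from the bound `3 * |C| ≤ 2 ^ n + 6`;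
  -- and `2 - log_2 3 = log_2 (4 / 3)`.
  refine ⟨fun n => 2 - rhoEdit 2 n 5, fun n => -Real.logb 2 (1 + 6 * (1 / 2) ^ n), ?_, ?_⟩
  · have h1 : Tendsto (fun n : ℕ => 1 + 6 * (1 / 2 : ℝ) ^ n) atTop (𝓝 (1 + 6 * 0)) :=
      ((tendsto_pow_atTop_nhds_zero_of_lt_one (by norm_num) (by norm_num)).const_mul 6).const_add 1
    have h2 := (h1.log (by norm_num)).div_const (Real.log 2)
    simpa [Real.logb] using h2.neg
  · intro n _
    refine ⟨(sub_sub_cancel _ _).symm, sub_nonneg.2 (rhoEdit_le_two le_rfl le_rfl), ?_⟩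
    have := le_rhoEdit (n := n) (N := 5) (q := 2) le_rfl (by norm_num)
      (B := 2 ^ n * ((1 + 6 * (1 / 2) ^ n) / 3)) fun C _ hC => by
        have h1 : (C.card : ℝ) * 3 ≤ 2 ^ n + 6 := by exact_mod_cast card_mul_three_le hC
        have h2 : (2 : ℝ) ^ n * (1 / 2) ^ n = 1 := by
          rw [← mul_pow]
          norm_num
        linarith
    push_cast at this
    rw [Real.logb_mul (by positivity) (by positivity), Real.logb_pow,
      Real.logb_self_eq_one (by norm_num), Real.logb_div (by positivity) (by norm_num)] at this
    have h4 : Real.logb 2 4 = 2 := by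
      rw [show (4 : ℝ) = 2 ^ 2 by norm_num, Real.logb_pow, Real.logb_self_eq_one (by norm_num)]
      norm_num
    rw [Real.logb_div (by norm_num) (by norm_num), h4]
    linarith

theorem exists_rhoEdit_two_six : ∃ δ : ℕ → ℝ, Tendsto δ atTop (𝓝 0) ∧
    ∀ n : ℕ, 1 ≤ n → rhoEdit 2 n 6 = 1 - δ n ∧ 0 ≤ δ n := by
  have hup : ∀ n : ℕ, 1 - rhoEdit 2 n 6 ≤ Real.logb 2 (1 + 2 * (1 / 2) ^ (n / 2)) := by
    intro n
    have := le_rhoEdit (n := n) (N := 6) (q := 2) le_rfl (by norm_num)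
      (B := 2 ^ n * ((1 + 2 * (1 / 2) ^ (n / 2)) / 2)) fun C _ hC => by
        have h1 : (C.card : ℝ) * 2 ≤ 2 ^ n + 2 * 2 ^ (n - n / 2) := by
          exact_mod_cast card_mul_two_le hC
        have h2 : (2 : ℝ) ^ n * (1 / 2) ^ (n / 2) = 2 ^ (n - n / 2) := by
          rw [pow_sub₀ _ (by norm_num) (Nat.div_le_self n 2), one_div, inv_pow]
        linarith
    push_cast at this
    rw [Real.logb_mul (by positivity) (by positivity), Real.logb_pow,
      Real.logb_self_eq_one (by norm_num), Real.logb_div (by positivity) (by norm_num),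
      Real.logb_self_eq_one (by norm_num)] at this
    linarith
  have hnn : ∀ n : ℕ, 0 ≤ 1 - rhoEdit 2 n 6 := fun n => sub_nonneg.2 rhoEdit_two_six_le
  refine ⟨fun n => 1 - rhoEdit 2 n 6, ?_, fun n _ => ⟨(sub_sub_cancel _ _).symm, hnn n⟩⟩
  refine squeeze_zero hnn hup ?_
  have h0 : Tendsto (fun n : ℕ => n / 2) atTop atTop :=
    Nat.tendsto_div_const_atTop (by norm_num)
  have h1 : Tendsto (fun n : ℕ => 1 + 2 * (1 / 2 : ℝ) ^ (n / 2)) atTop (𝓝 (1 + 2 * 0)) :=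
    (((tendsto_pow_atTop_nhds_zero_of_lt_one (by norm_num) (by norm_num)).comp h0).const_mul
      2).const_add 1
  have h2 := (h1.log (by norm_num)).div_const (Real.log 2)
  simpa [Real.logb] using h2

theorem mainTheorem12 :
    -- the binary case
    ((∀ N : ℕ, N = 1 ∨ N = 2 →
        (fun n : ℕ => rhoEdit 2 n N - Real.logb 2 n) =O[atTop] (fun _ => (1 : ℝ))) ∧
      (∀ N : ℕ, N = 3 ∨ N = 4 →
        (fun n : ℕ => rhoEdit 2 n N - Real.logb 2 (Real.logb 2 n))
          =O[atTop] (fun _ => (1 : ℝ))) ∧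
      (∃ ε δ : ℕ → ℝ, Tendsto δ atTop (𝓝 0) ∧
        ∀ n : ℕ, 1 ≤ n →
          rhoEdit 2 n 5 = 2 - ε n ∧ 0 ≤ ε n ∧ ε n ≤ Real.logb 2 (4 / 3) - δ n) ∧
      (∃ δ : ℕ → ℝ, Tendsto δ atTop (𝓝 0) ∧
        ∀ n : ℕ, 1 ≤ n → rhoEdit 2 n 6 = 1 - δ n ∧ 0 ≤ δ n) ∧
      (∀ N : ℕ, 7 ≤ N → ∀ n : ℕ, 1 ≤ n → rhoEdit 2 n N = 0)) ∧
    -- the case of larger alphabets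
    (∀ q : ℕ, 3 ≤ q →
      (∀ N : ℕ, N = 1 ∨ N = 2 →
        (fun n : ℕ => rhoEdit q n N - Real.logb q n)
          =O[atTop] (fun n : ℕ => Real.logb q (Real.logb q n))) ∧
      (∀ N : ℕ, N = 3 ∨ N = 4 →
        (fun n : ℕ => rhoEdit q n N - Real.logb q (Real.logb q n))
          =O[atTop] (fun _ => (1 : ℝ))) ∧
      (∀ N : ℕ, N = 5 ∨ N = 6 →
        ∃ ε : ℕ → ℝ, ∀ n : ℕ, 1 ≤ n →
          rhoEdit q n N = 2 - ε n ∧ 0 ≤ ε n ∧ ε n ≤ 1) ∧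
      (∀ N : ℕ, 7 ≤ N → N ≤ q + 3 → ∀ n : ℕ, 1 ≤ n → rhoEdit q n N = 1) ∧
      (∀ N : ℕ, q + 4 ≤ N → ∀ n : ℕ, 1 ≤ n → rhoEdit q n N = 0)) := by
  refine ⟨⟨?_, ?_, exists_rhoEdit_two_five, exists_rhoEdit_two_six, ?_⟩, fun q hq => ⟨?_, ?_, ?_, ?_, ?_⟩⟩
  · intro N hN
    exact rhoEdit_two_sub_isBigO (by omega) (by omega)
  · intro N hN
    exact_mod_cast rhoEdit_sub_logb_logb_isBigO (q := 2) (N := N) le_rfl (by omega) (by omega)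
  · intro N hN n _
    exact rhoEdit_eq_zero le_rfl hN (by omega)
  · intro N hN
    exact rhoEdit_sub_isBigO (by omega) (by omega) (by omega)
  · intro N hN
    exact rhoEdit_sub_logb_logb_isBigO (by omega) (by omega) (by omega)
  · intro N hN
    refine ⟨fun n => 2 - rhoEdit q n N, fun n hn => ⟨(sub_sub_cancel _ _).symm, ?_, ?_⟩⟩
    · exact sub_nonneg.2 (rhoEdit_le_two (by omega) (by omega))
    · have := one_le_rhoEdit (q := q) (N := N) (by omega) hn (by omega) (by omega)
      linarith
  · intro N h7 hN n hn
    exact le_antisymm (rhoEdit_le_one (by omega) h7) (one_le_rhoEdit (by omega) hn (by omega) hN)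
  · intro N hN n _
    exact rhoEdit_eq_zero (by omega) (by omega) hN
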